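/- Fix a field $K$ of coefficients. For a function $f:[0,1]^d\to[0,1]$ and $k\ge 0$, consider the persistence module $t\mapsto H_k(\{f\le t\};K)$, $t\in\mathbb{R}$ (singular homology of the sublevel sets). We say that $f$ is tame if for every $k$ and all $s<t$ the map $H_k(\{f\le s\};K)\to H_k(\{f\le t\};K)$ has finite rank; the persistence diagrams of $f$ are then well defined. The total persistence $\chi(f)\in[0,\infty]$ is the sum, over all $k\geq 0$ and all points $(b,d)$ with $b<d\le\infty$ of the $k$-th persistence diagram (with multiplicity), of $d-b$, where for $d=\infty$ the persistence is replaced by $\sup f-b$. For $V\ge 0$ let $$\mathcal{H}_V=\{f:[0,1]^d\to[0,1]\ \mid\ f \text{ tame},\ \chi(f)\le V\}.$$ For a class $\mathcal F$ of functions $[0,1]^d\to[0,1]$ and $\gamma>0$, a finite set $S$ is $\gamma$-shattered if there are thresholds $(r_x)_{x\in S}$ such that for every $E\subseteq S$ there is $f_E\in\mathcal F$ with $f_E(x)\ge r_x+\gamma$ for $x\in E$ and $f_E(x)\le r_x-\gamma$ for $x\in S\setminus E$. The fat-shattering dimension $\mathrm{fat}_\gamma(\mathcal F)$ is the largest cardinality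 of a $\gamma$-shattered finite set, and $\infty$ if there are arbitrarily large ones. Write $\mathrm{fat}^{<}_\gamma(\mathcal F)$ for the variant in which the lower inequality is strict, $f_E(x)<r_x-\gamma$. **Theorem.** Let $V\ge 0$ and $0<\gamma<1/2$. Let $\mathcal H$ be either $\mathcal H_V$ or its subclass of continuous functions. - If $d=1$, then $\mathrm{fat}_\gamma(\mathcal H)\le 1+\lfloor V/\gamma\rfloor$ and $\mathrm{fat}^{<}_\gamma(\mathcal H)\le 1+\lfloor V/\gamma\rfloor$. - If $d\ge 2$, then $\mathrm{fat}_\gamma(\mathcal H)=\infty$ if $2\gamma\le V$, and $\mathrm{fat}_\gamma(\mathcal H)=1$ otherwise. Likewise $\mathrm{fat}^{<}_\gamma(\mathcal H)=\infty$ if $2\gamma<V$, and $\mathrm{fat}^{<}_\gamma(\mathcal H)=1$ otherwise. -/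

import Mathlib

open CategoryTheory

universe u

/-- The unit cube `[0,1]^d`, with its usual (product) topology. -/
abbrev UnitCube (d : ℕ) : Type := Fin d → unitInterval

section Persistence

/-- The filtration of a space `X` by the sublevel sets `{x | f x ≤ t}`, `t ∈ ℝ`, with the
inclusions between them. -/
def sublevelFiltration {X : Type} [TopologicalSpace X] (f : X → ℝ) : ℝ ⥤ TopCat.{0} where
  obj t := TopCat.of {x : X // f x ≤ t}
  map {s t} h := TopCat.ofHom
    ⟨fun x => ⟨x.1, x.2.trans (leOfHom h)⟩, continuous_subtype_val.subtype_mk _⟩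

/-- The `k`-th sublevel set persistence module of `f`: the singular homology, with coefficients
in the field `K`, of the sublevel sets of `f`. -/
noncomputable def sublevelHomology (K : Type u) [Field K] {X : Type} [TopologicalSpace X]
    (f : X → ℝ) (k : ℕ) : ℝ ⥤ ModuleCat.{u} K :=
  sublevelFiltration f ⋙
    (AlgebraicTopology.singularHomologyFunctor (ModuleCat.{u} K) k).obj (ModuleCat.of K K)

variable {K : Type u} [Field K] (M : ℝ ⥤ ModuleCat.{u} K)

/-- A persistence module is q-tame if all its structure maps `M s → M t` with `s < t` have finite
rank. This is what is needed for the persistence diagram to be well defined. -/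
def QTame : Prop :=
  ∀ ⦃s t : ℝ⦄ (h : s < t), FiniteDimensional K (LinearMap.range (M.map (homOfLE h.le)).hom)

open scoped Classical in
/-- The rank of the structure map `M s → M t` (used for `s ≤ t` only). -/
noncomputable def persistentRank (s t : ℝ) : ℕ :=
  if h : s ≤ t then Module.finrank K (LinearMap.range (M.map (homOfLE h)).hom) else 0

/-- The number of features of `M` that are born in `(a, b]` and die in `(c, d]`, where
`a < b < c < d`, that is `r(b,c) - r(a,c) - r(b,d) + r(a,d)` (a number that is nonnegative when
`M` is q-tame). -/
noncomputable def featureCount (a b c d : ℝ) : ℕ :=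
  (persistentRank M b c + persistentRank M a d) - (persistentRank M a c + persistentRank M b d)

/-- The multiplicity of the point `(b, d)`, `b < d < ∞`, in the persistence diagram of `M`: the
number of features with birth and death in arbitrarily small squares around `(b, d)`. It is `0` if
`d ≤ b`. -/
noncomputable def diagramMult (b d : ℝ) : ℕ :=
  ⨅ ε : {ε : ℝ // 0 < ε ∧ b + ε < d - ε}, featureCount M (b - ε) (b + ε) (d - ε) (d + ε)

/-- The multiplicity of the point `(b, ∞)` in the persistence diagram of `M`: the number of
features that are born arbitrarily close to `b` and live arbitrarily long. -/
noncomputable def diagramMultTop (b : ℝ) : ℕ :=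
  ⨅ p : {p : ℝ × ℝ // 0 < p.1 ∧ b + p.1 < p.2},
    (persistentRank M (b + p.1.1) p.1.2 - persistentRank M (b - p.1.1) p.1.2)

/-- The sum of the persistences `d - b` of all the points of the persistence diagram of `M`, where
the infinite persistence of a feature `(b, ∞)` is replaced by `top - b`. -/
noncomputable def clippedPersistence (top : ℝ) : ENNReal :=
  (∑' p : ℝ × ℝ, (diagramMult M p.1 p.2 : ENNReal) * ENNReal.ofReal (p.2 - p.1)) +
    ∑' b : ℝ, (diagramMultTop M b : ENNReal) * ENNReal.ofReal (top - b)

/-- The total persistence `χ(f) = ∑ₖ χₖ(f)` of a function `f` over all homological dimensions;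
infinite persistences are clipped at the maximum (supremum) of `f`. -/
noncomputable def totalPersistence (K : Type u) [Field K] {X : Type} [TopologicalSpace X]
    (f : X → ℝ) : ENNReal :=
  ∑' k : ℕ, clippedPersistence (sublevelHomology K f k) (sSup (Set.range f))

/-- The class `H_V` of the functions `[0,1]^d → [0,1]` whose persistence diagrams are well defined
and whose total persistence is at most `V`. -/
def boundedPersistenceClass (K : Type u) [Field K] (d : ℕ) (V : ℝ) :
    Set (UnitCube d → unitInterval) :=
  {f | (∀ k : ℕ, QTame (sublevelHomology K (fun x => (f x : ℝ)) k)) ∧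
    totalPersistence K (fun x => (f x : ℝ)) ≤ ENNReal.ofReal V}

end Persistence

section FatShattering

variable {X : Type*}

/-- `S` is `γ`-shattered by the class `F` of `[0,1]`-valued functions. -/
def IsFatShattered (γ : ℝ) (F : Set (X → unitInterval)) (S : Finset X) : Prop :=
  ∃ r : X → ℝ, ∀ E ⊆ S, ∃ f ∈ F, ∀ x ∈ S,
    (x ∈ E → r x + γ ≤ (f x : ℝ)) ∧ (x ∉ E → (f x : ℝ) ≤ r x - γ)

/-- The variant of `γ`-shattering in which the lower inequality is strict. -/
def IsFatShatteredStrict (γ : ℝ) (F : Set (X → unitInterval)) (S : Finset X) : Prop :=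
  ∃ r : X → ℝ, ∀ E ⊆ S, ∃ f ∈ F, ∀ x ∈ S,
    (x ∈ E → r x + γ ≤ (f x : ℝ)) ∧ (x ∉ E → (f x : ℝ) < r x - γ)

/-- The fat-shattering dimension of `F` at scale `γ`: the largest size of a finite `γ`-shattered
set, and `⊤` if there are arbitrarily large ones. -/
noncomputable def fatDim (γ : ℝ) (F : Set (X → unitInterval)) : ℕ∞ :=
  ⨆ (S : Finset X) (_ : IsFatShattered γ F S), (S.card : ℕ∞)

/-- The fat-shattering dimension for the variant with a strict lower inequality. -/
noncomputable def fatDimStrict (γ : ℝ) (F : Set (X → unitInterval)) : ℕ∞ :=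
  ⨆ (S : Finset X) (_ : IsFatShatteredStrict γ F S), (S.card : ℕ∞)

end FatShattering

/-!
The statement is reduced to three estimates for the total persistence `χ`.

**Lower bounds for `χ`.** The diagram multiplicities are defined as infima of the masses
`r(b,c) - r(a,c) - r(b,d) + r(a,d)` of small boxes, where `r` is the rank function. By the Frobenius
rank inequality these masses are nonnegative for a q-tame module, and they are additive; covering
a box by small squares that each carry no more than the multiplicity of their centre shows that
`r(s,t)` is at most the number of diagram points born until `s` and dying from `t` on
(`QTame.persistentRank_le_tsum`). Writing the persistence of a point as the length of the set of
levels at which it is alive, one gets `∫ N(t) dt ≤ χ` whenever `N(t)` bounds the ranks near level `t`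
from below (`QTame.lintegral_le_clippedPersistence`). In degree `0` the ranks are bounded below by
counting points of the lower sublevel set that lie in different pieces of the upper one. One
point gives `sup f - inf f ≤ χ(f)` in every dimension. On the interval, the blocks of consecutive
points below level `t` give half the number of crossings of that level, so that `χ(f)` is at least
half the variation of `f` along any increasing sequence of points
(`sum_abs_sub_le_clippedPersistence`).

**Upper bound for `χ`.** If all nonempty sublevel sets are contractible, homotopy invariance of
singular homology leaves the single diagram point `(inf f, ∞)` in degree `0`, and
`χ(f) ≤ sup f - inf f` (`totalPersistence_le_of_contractible_sublevels`).

**Shattering.** On the interval, functions that are above the thresholds at every other point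
and the complementary functions vary together by `4γ` between consecutive points, which bounds the
number of points. In dimension at least two, a two-point set is shattered only if some function
has oscillation at least `2γ`. Conversely, points on a parabola can be separated at the levels `0`
and `h` by maxima of truncated affine functions, whose sublevel sets are convex, so that `χ ≤ h`
for all of them (`exists_separated_finset`).
-/

/-! ### Rank functions of q-tame persistence modules -/

section Rank

variable {K : Type u} [Field K]

/-- The Frobenius rank inequality, for a map `g` of finite rank. -/
theorem finrank_range_comp_add_le {A B C D : Type*} [AddCommGroup A] [Module K A]
    [AddCommGroup B] [Module K B] [AddCommGroup C] [Module K C] [AddCommGroup D] [Module K D]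
    (h : A →ₗ[K] B) (g : B →ₗ[K] C) (f : C →ₗ[K] D) [FiniteDimensional K (LinearMap.range g)] :
    Module.finrank K (LinearMap.range (g ∘ₗ h)) + Module.finrank K (LinearMap.range (f ∘ₗ g)) ≤
      Module.finrank K (LinearMap.range g) +
        Module.finrank K (LinearMap.range (f ∘ₗ g ∘ₗ h)) := by
  -- `W` is the range of `g` and `U ≤ W` that of `g ∘ h`: restricting `f` to `W` and to `U`,
  -- rank-nullity reduces the inequality to `ker (f|U) ≤ ker (f|W)`.
  have hU : LinearMap.range (g ∘ₗ h) ≤ LinearMap.range g := LinearMap.range_comp_le_range h g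
  have : FiniteDimensional K (LinearMap.range (g ∘ₗ h)) :=
    Submodule.finiteDimensional_of_le hU
  have e1 := LinearMap.finrank_range_add_finrank_ker (f.domRestrict (LinearMap.range g))
  have e2 := LinearMap.finrank_range_add_finrank_ker (f.domRestrict (LinearMap.range (g ∘ₗ h)))
  have r1 : LinearMap.range (f.domRestrict (LinearMap.range g)) = LinearMap.range (f ∘ₗ g) := by
    rw [LinearMap.range_domRestrict, LinearMap.range_comp]
  have r2 : LinearMap.range (f.domRestrict (LinearMap.range (g ∘ₗ h))) =
      LinearMap.range (f ∘ₗ g ∘ₗ h) := by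
    rw [LinearMap.range_domRestrict, LinearMap.range_comp (g ∘ₗ h) f]
  rw [r1] at e1
  rw [r2] at e2
  have k : Module.finrank K (LinearMap.ker (f.domRestrict (LinearMap.range (g ∘ₗ h)))) ≤
      Module.finrank K (LinearMap.ker (f.domRestrict (LinearMap.range g))) := by
    refine LinearMap.finrank_le_finrank_of_injective
      (f := (Submodule.inclusion hU).restrict (p := LinearMap.ker _) (q := LinearMap.ker _)
        fun x hx => ?_) ?_
    · simpa using hx
    · intro x y hxy
      apply Subtype.ext
      apply Submodule.inclusion_injective hU
      simpa using congrArg Subtype.val hxy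
  omega

variable {M : ℝ ⥤ ModuleCat.{u} K}

theorem persistentRank_of_le {s t : ℝ} (h : s ≤ t) :
    persistentRank M s t = Module.finrank K (LinearMap.range (M.map (homOfLE h)).hom) :=
  dif_pos h

theorem map_homOfLE_comp {a b c : ℝ} (hab : a ≤ b) (hbc : b ≤ c) :
    (M.map (homOfLE (hab.trans hbc))).hom =
      (M.map (homOfLE hbc)).hom ∘ₗ (M.map (homOfLE hab)).hom := by
  rw [← ModuleCat.hom_comp, ← M.map_comp]
  rfl

theorem QTame.persistentRank_mono_left (hM : QTame M) {a b c : ℝ} (hab : a ≤ b) (hbc : b < c) :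
    persistentRank M a c ≤ persistentRank M b c := by
  rw [persistentRank_of_le (hab.trans hbc.le), persistentRank_of_le hbc.le,
    map_homOfLE_comp hab hbc.le]
  have := hM hbc
  exact Submodule.finrank_mono (LinearMap.range_comp_le_range _ _)

/-- The rank function of a q-tame module gives nonnegative mass to boxes above the diagonal. -/
theorem QTame.persistentRank_add_le (hM : QTame M) {a b c d : ℝ} (hab : a ≤ b) (hbc : b < c)
    (hcd : c ≤ d) : persistentRank M a c + persistentRank M b d ≤
      persistentRank M b c + persistentRank M a d := by
  rw [persistentRank_of_le (hab.trans hbc.le), persistentRank_of_le hbc.le,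
    persistentRank_of_le (hbc.le.trans hcd), persistentRank_of_le (hab.trans (hbc.le.trans hcd)),
    map_homOfLE_comp hab (hbc.le.trans hcd), map_homOfLE_comp hbc.le hcd,
    map_homOfLE_comp hab hbc.le]
  have := hM hbc
  exact finrank_range_comp_add_le _ _ _

end Rank

/-! ### Ranks are bounded by counts of diagram points -/

section Covering

/-- A function that is monotone at small scale is monotone. -/
theorem le_of_forall_le_of_sub_lt {g : ℝ → ℤ} {a b δ : ℝ} (hδ : 0 < δ) (hab : a ≤ b)
    (h : ∀ x y, a ≤ x → x ≤ y → y ≤ b → y - x < δ → g x ≤ g y) : g a ≤ g b := by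
  have key : ∀ n : ℕ, ∀ y, a ≤ y → y ≤ b → y - a ≤ n * (δ / 2) → g a ≤ g y := by
    intro n
    induction n with
    | zero =>
      intro y h1 h2 h3
      have : y = a := by simp at h3; linarith
      rw [this]
    | succ n ih =>
      intro y h1 h2 h3
      push_cast at h3
      have hy : max a (y - δ / 2) ≤ y := max_le h1 (by linarith)
      refine (ih (max a (y - δ / 2)) (le_max_left _ _) (hy.trans h2) ?_).trans
        (h _ y (le_max_left _ _) hy h2 ?_)
      · rw [sub_le_iff_le_add]
        exact max_le (by have : 0 ≤ (n : ℝ) * (δ / 2) := by positivity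
                         linarith) (by linarith)
      · have := le_max_right a (y - δ / 2)
        linarith
  obtain ⟨n, hn⟩ := exists_nat_ge ((b - a) / (δ / 2))
  exact key n b hab le_rfl (by rwa [div_le_iff₀ (by positivity)] at hn)

/-- A box function `D(b,c) - D(a,c) - D(b,d) + D(a,d)` that is nonnegative on the small boxes
inside a given box is nonnegative on the whole box. -/
theorem box_nonneg_of_forall_small {D : ℝ → ℝ → ℤ} {a b c d δ : ℝ} (hδ : 0 < δ) (hab : a ≤ b)
    (hcd : c ≤ d)
    (h : ∀ x x' y y', a ≤ x → x ≤ x' → x' ≤ b → x' - x < δ → c ≤ y → y ≤ y' → y' ≤ d →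
      y' - y < δ → 0 ≤ D x' y - D x y - D x' y' + D x y') :
    0 ≤ D b c - D a c - D b d + D a d := by
  have := le_of_forall_le_of_sub_lt (g := fun y => D a y - D b y) hδ hcd
    fun y y' h1 h2 h3 h4 => by
      have := le_of_forall_le_of_sub_lt (g := fun x => D x y - D x y') hδ hab
        fun x x' k1 k2 k3 k4 => by
          have := h x x' y y' k1 k2 k3 k4 h1 h2 h3 h4
          linarith
      linarith
  linarith

/-- Projection of the real line to an interval; `max lo (min hi x)`. -/
noncomputable def clampTo (lo hi x : ℝ) : ℝ := max lo (min hi x)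

theorem clampTo_mono (lo hi : ℝ) : Monotone (clampTo lo hi) := fun _ _ h =>
  max_le_max le_rfl (min_le_min le_rfl h)

theorem le_clampTo (lo hi x : ℝ) : lo ≤ clampTo lo hi x := le_max_left _ _

theorem clampTo_le {lo hi : ℝ} (h : lo ≤ hi) (x : ℝ) : clampTo lo hi x ≤ hi :=
  max_le h (min_le_left _ _)

theorem clampTo_eq {lo hi x : ℝ} (h1 : lo ≤ x) (h2 : x ≤ hi) : clampTo lo hi x = x := by
  rw [clampTo, min_eq_right h2, max_eq_right h1]

variable {K : Type u} [Field K] {M : ℝ ⥤ ModuleCat.{u} K}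

theorem exists_featureCount_eq_diagramMult (M : ℝ ⥤ ModuleCat.{u} K) {b d : ℝ} (h : b < d) :
    ∃ ε : ℝ, 0 < ε ∧ b + ε < d - ε ∧
      featureCount M (b - ε) (b + ε) (d - ε) (d + ε) = diagramMult M b d := by
  have : Nonempty {ε : ℝ // 0 < ε ∧ b + ε < d - ε} :=
    ⟨⟨(d - b) / 4, by linarith, by linarith⟩⟩
  obtain ⟨ε, hε⟩ := Nat.sInf_mem (Set.range_nonempty
    fun ε : {ε : ℝ // 0 < ε ∧ b + ε < d - ε} =>
      featureCount M (b - ε) (b + ε) (d - ε) (d + ε))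
  exact ⟨ε, ε.2.1, ε.2.2, hε⟩

theorem exists_sub_eq_diagramMultTop (M : ℝ ⥤ ModuleCat.{u} K) (b : ℝ) :
    ∃ ε T : ℝ, 0 < ε ∧ b + ε < T ∧
      persistentRank M (b + ε) T - persistentRank M (b - ε) T = diagramMultTop M b := by
  have : Nonempty {p : ℝ × ℝ // 0 < p.1 ∧ b + p.1 < p.2} :=
    ⟨⟨(1, b + 2), by norm_num, by norm_num⟩⟩
  obtain ⟨p, hp⟩ := Nat.sInf_mem (Set.range_nonempty
    fun p : {p : ℝ × ℝ // 0 < p.1 ∧ b + p.1 < p.2} =>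
      (persistentRank M (b + p.1.1) p.1.2 - persistentRank M (b - p.1.1) p.1.2))
  exact ⟨p.1.1, p.1.2, p.2.1, p.2.2, hp⟩

/-- The mass of a box is at most the feature count of a larger box above the diagonal. -/
theorem QTame.le_featureCount (hM : QTame M) {a b c d a' b' c' d' : ℝ} (h1 : a ≤ a')
    (h2 : a' ≤ b') (h3 : b' ≤ b) (hbc : b < c) (h4 : c ≤ c') (h5 : c' ≤ d') (h6 : d' ≤ d) :
    (persistentRank M b' c' - persistentRank M a' c' - persistentRank M b' d' +
      persistentRank M a' d' : ℤ) ≤ featureCount M a b c d := by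
  -- the four strips around the inner box have nonnegative mass
  have e1 := hM.persistentRank_add_le (a := a) (b := a') (c := c) (d := d) h1 (by linarith)
    (by linarith)
  have e2 := hM.persistentRank_add_le (a := b') (b := b) (c := c) (d := d) h3 hbc (by linarith)
  have e3 := hM.persistentRank_add_le (a := a') (b := b') (c := c) (d := c') h2 (by linarith) h4
  have e4 := hM.persistentRank_add_le (a := a') (b := b') (c := d') (d := d) h2 (by linarith) h6
  unfold featureCount
  omega

/-- The mass of a box is carried by finitely many diagram points in its closure. -/
theorem QTame.exists_box_le_sum (hM : QTame M) {a s t c : ℝ} (has : a ≤ s) (hst : s < t)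
    (htc : t ≤ c) :
    ∃ F : Finset (ℝ × ℝ), (∀ p ∈ F, p.1 ≤ s ∧ t ≤ p.2) ∧
      (persistentRank M s t - persistentRank M a t - persistentRank M s c +
        persistentRank M a c : ℤ) ≤ ∑ p ∈ F, (diagramMult M p.1 p.2 : ℤ) := by
  choose! ε hε0 hε hεm using fun p : ℝ × ℝ => fun h : p.1 < p.2 =>
    exists_featureCount_eq_diagramMult M h
  have hK : IsCompact (Set.Icc a s ×ˢ Set.Icc t c) := isCompact_Icc.prod isCompact_Icc
  have hlt : ∀ p ∈ Set.Icc a s ×ˢ Set.Icc t c, p.1 < p.2 := fun p hp =>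
    lt_of_le_of_lt hp.1.2 (lt_of_lt_of_le hst hp.2.1)
  obtain ⟨F, hFK, hF⟩ := hK.elim_nhds_subcover (fun p => Metric.ball p (ε p))
    fun p hp => Metric.ball_mem_nhds p (hε0 p (hlt p hp))
  obtain ⟨δ, hδ, hleb⟩ := lebesgue_number_lemma_of_metric hK
    (c := fun p : F => Metric.ball p.1 (ε p.1)) (fun _ => Metric.isOpen_ball)
    (by simpa [Set.iUnion_subtype] using hF)
  refine ⟨F, fun p hp => ⟨(hFK p hp).1.2, (hFK p hp).2.1⟩, ?_⟩
  set X : ℝ × ℝ → ℝ → ℝ := fun p => clampTo (p.1 - ε p) (p.1 + ε p) with hX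
  set Y : ℝ × ℝ → ℝ → ℝ := fun p => clampTo (p.2 - ε p) (p.2 + ε p) with hY
  set r : ℝ → ℝ → ℤ := fun x y => persistentRank M x y with hr
  have hXm : ∀ p, Monotone (X p) := fun p => clampTo_mono _ _
  have hYm : ∀ p, Monotone (Y p) := fun p => clampTo_mono _ _
  have hXl : ∀ p ∈ F, ∀ x, p.1 - ε p ≤ X p x := fun p _ x => le_clampTo _ _ _
  have hXu : ∀ p ∈ F, ∀ x, X p x ≤ p.1 + ε p := fun p hp x =>
    clampTo_le (by have := hε0 p (hlt p (hFK p hp)); linarith) _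
  have hYl : ∀ p ∈ F, ∀ x, p.2 - ε p ≤ Y p x := fun p _ x => le_clampTo _ _ _
  have hYu : ∀ p ∈ F, ∀ x, Y p x ≤ p.2 + ε p := fun p hp x =>
    clampTo_le (by have := hε0 p (hlt p (hFK p hp)); linarith) _
  -- the box mass is subadditive: compare it with the mass of the parts inside the squares
  have main := box_nonneg_of_forall_small
    (D := fun x y => ∑ p ∈ F, r (X p x) (Y p y) - r x y) hδ has htc
    fun x x' y y' h1 h2 h3 h4 k1 k2 k3 k4 => by
      obtain ⟨⟨q, hq⟩, hqb⟩ := hleb (x', y') ⟨⟨h1.trans h2, h3⟩, ⟨k1.trans k2, k3⟩⟩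
      have hxy : (x, y) ∈ Metric.ball q (ε q) := hqb (by
        rw [Metric.mem_ball, Prod.dist_eq, Real.dist_eq, Real.dist_eq, abs_of_nonpos (by
          dsimp only; linarith), abs_of_nonpos (by dsimp only; linarith)]
        exact max_lt (by dsimp only; linarith) (by dsimp only; linarith))
      have hxy' : (x', y') ∈ Metric.ball q (ε q) := hqb (Metric.mem_ball_self hδ)
      rw [Metric.mem_ball, Prod.dist_eq, max_lt_iff, Real.dist_eq, Real.dist_eq, abs_lt,
        abs_lt] at hxy hxy'
      dsimp only at hxy hxy'
      have hnn : ∀ p ∈ F, 0 ≤ r (X p x') (Y p y) - r (X p x) (Y p y) - r (X p x') (Y p y') +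
          r (X p x) (Y p y') := fun p hp => by
        have := hM.persistentRank_add_le (hXm p h2)
          (lt_of_le_of_lt (hXu p hp x') (lt_of_lt_of_le (hε p (hlt p (hFK p hp)))
            (hYl p hp y))) (hYm p k2)
        simp only [hr]
        omega
      have hle := Finset.single_le_sum hnn hq
      have e1 : X q x = x := clampTo_eq (by linarith [hxy.1.1]) (by linarith [hxy.1.2])
      have e2 : X q x' = x' := clampTo_eq (by linarith [hxy'.1.1]) (by linarith [hxy'.1.2])
      have e3 : Y q y = y := clampTo_eq (by linarith [hxy.2.1]) (by linarith [hxy.2.2])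
      have e4 : Y q y' = y' := clampTo_eq (by linarith [hxy'.2.1]) (by linarith [hxy'.2.2])
      rw [e1, e2, e3, e4] at hle
      simp only [Finset.sum_add_distrib, Finset.sum_sub_distrib] at hle
      linarith
  have hsum : ∑ p ∈ F, (r (X p s) (Y p t) - r (X p a) (Y p t) - r (X p s) (Y p c) +
      r (X p a) (Y p c)) ≤ ∑ p ∈ F, (diagramMult M p.1 p.2 : ℤ) := by
    refine Finset.sum_le_sum fun p hp => ?_
    rw [← hεm p (hlt p (hFK p hp))]
    exact hM.le_featureCount (hXl p hp a) (clampTo_mono _ _ has) (hXu p hp s)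
      (hε p (hlt p (hFK p hp))) (hYl p hp t) (clampTo_mono _ _ htc) (hYu p hp c)
  simp only [Finset.sum_add_distrib, Finset.sum_sub_distrib] at hsum
  simp only [hr] at hsum main ⊢
  linarith

/-- If the module is constant from the parameter `1` on, then the features born in `(a, s]` that
never die are accounted for by finitely many points `(b, ∞)` with `b ≤ s`. -/
theorem QTame.exists_top_le_sum (hM : QTame M)
    (h1 : ∀ x y z : ℝ, x ≤ y → 1 ≤ y → y ≤ z → persistentRank M x y = persistentRank M x z)
    {a s T : ℝ} (has : a ≤ s) (hsT : s < T) (hT : 1 ≤ T) :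
    ∃ F : Finset ℝ, (∀ b ∈ F, b ≤ s) ∧
      (persistentRank M s T - persistentRank M a T : ℤ) ≤ ∑ b ∈ F, (diagramMultTop M b : ℤ) := by
  choose ε U hε0 hε hεm using exists_sub_eq_diagramMultTop M
  obtain ⟨F, hFK, hF⟩ := (isCompact_Icc (a := a) (b := s)).elim_nhds_subcover
    (fun p => Metric.ball p (ε p)) fun p hp => Metric.ball_mem_nhds p (hε0 p)
  obtain ⟨δ, hδ, hleb⟩ := lebesgue_number_lemma_of_metric (isCompact_Icc (a := a) (b := s))
    (c := fun p : F => Metric.ball p.1 (ε p.1)) (fun _ => Metric.isOpen_ball)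
    (by simpa [Set.iUnion_subtype] using hF)
  refine ⟨F, fun p hp => (hFK p hp).2, ?_⟩
  set X : ℝ → ℝ → ℝ := fun p => clampTo (p - ε p) (p + ε p) with hX
  have hXl : ∀ p x, p - ε p ≤ X p x := fun p x => le_clampTo _ _ _
  have hXu : ∀ p x, X p x ≤ p + ε p := fun p x =>
    clampTo_le (by have := hε0 p; linarith) _
  have main := le_of_forall_le_of_sub_lt
    (g := fun x => ∑ p ∈ F, (persistentRank M (X p x) (U p) : ℤ) - persistentRank M x T) hδ has
    fun x x' k1 k2 k3 k4 => by
      obtain ⟨⟨q, hq⟩, hqb⟩ := hleb x' ⟨k1.trans k2, k3⟩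
      have hx : x ∈ Metric.ball q (ε q) := hqb (by
        rw [Metric.mem_ball, Real.dist_eq, abs_of_nonpos (by linarith)]; linarith)
      have hx' : x' ∈ Metric.ball q (ε q) := hqb (Metric.mem_ball_self hδ)
      rw [Metric.mem_ball, Real.dist_eq, abs_lt] at hx hx'
      have hnn : ∀ p ∈ F, (0 : ℤ) ≤ persistentRank M (X p x') (U p) -
          persistentRank M (X p x) (U p) := fun p hp => by
        have := hM.persistentRank_mono_left (clampTo_mono (p - ε p) (p + ε p) k2)
          (lt_of_le_of_lt (hXu p x') (hε p))
        simp only [hX]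
        omega
      have hle := Finset.single_le_sum hnn hq
      have e1 : X q x = x := clampTo_eq (by linarith [hx.1]) (by linarith [hx.2])
      have e2 : X q x' = x' := clampTo_eq (by linarith [hx'.1]) (by linarith [hx'.2])
      rw [e1, e2, Finset.sum_sub_distrib] at hle
      -- compare the deaths after `U q` and after `T` through a common later parameter
      have f := hM.persistentRank_add_le (c := U q) (d := max T (U q)) k2
        (by linarith [hx'.2, hε q]) (le_max_right _ _)
      have f1 := h1 x T (max T (U q)) (by linarith) hT (le_max_left _ _)
      have f2 := h1 x' T (max T (U q)) (by linarith) hT (le_max_left _ _)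
      omega
  have hsum : ∑ p ∈ F, (persistentRank M (X p s) (U p) - persistentRank M (X p a) (U p) : ℤ) ≤
      ∑ p ∈ F, (diagramMultTop M p : ℤ) := by
    refine Finset.sum_le_sum fun p hp => ?_
    rw [← hεm p]
    have g1 := hM.persistentRank_mono_left (hXu p s) (hε p)
    have g2 := hM.persistentRank_mono_left (hXl p a) (lt_of_le_of_lt (hXu p a) (hε p))
    omega
  rw [Finset.sum_sub_distrib] at hsum
  linarith

/-- The rank of `M s → M t` is at most the number of diagram points that are born until `s` and
die from `t` on. -/
theorem QTame.persistentRank_le_tsum (hM : QTame M)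
    (h0 : ∀ x y : ℝ, x < 0 → persistentRank M x y = 0)
    (h1 : ∀ x y z : ℝ, x ≤ y → 1 ≤ y → y ≤ z → persistentRank M x y = persistentRank M x z)
    {s t : ℝ} (hst : s < t) :
    (persistentRank M s t : ENNReal) ≤
      (∑' p : ℝ × ℝ, {p : ℝ × ℝ | p.1 ≤ s ∧ t ≤ p.2}.indicator
        (fun p => (diagramMult M p.1 p.2 : ENNReal)) p) +
      ∑' b : ℝ, (Set.Iic s).indicator (fun b => (diagramMultTop M b : ENNReal)) b := by
  obtain ⟨a, ha0, has⟩ : ∃ a : ℝ, a < 0 ∧ a ≤ s :=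
    ⟨min (-1) s, lt_of_le_of_lt (min_le_left _ _) (by norm_num), min_le_right _ _⟩
  obtain ⟨F, hF, hFs⟩ := hM.exists_box_le_sum has hst (le_max_left t 1)
  obtain ⟨G, hG, hGs⟩ := hM.exists_top_le_sum h1 has (lt_of_lt_of_le hst (le_max_left t 1))
    (le_max_right t 1)
  rw [h0 a _ ha0, h0 a _ ha0] at hFs
  rw [h0 a _ ha0] at hGs
  have hN : persistentRank M s t ≤
      ∑ p ∈ F, diagramMult M p.1 p.2 + ∑ b ∈ G, diagramMultTop M b := by
    have : (persistentRank M s t : ℤ) ≤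
        ((∑ p ∈ F, diagramMult M p.1 p.2 + ∑ b ∈ G, diagramMultTop M b : ℕ) : ℤ) := by
      push_cast at hFs hGs ⊢
      linarith
    exact_mod_cast this
  calc (persistentRank M s t : ENNReal)
      ≤ ((∑ p ∈ F, diagramMult M p.1 p.2 + ∑ b ∈ G, diagramMultTop M b : ℕ) : ENNReal) := by
        exact_mod_cast hN
    _ = (∑ p ∈ F, {p : ℝ × ℝ | p.1 ≤ s ∧ t ≤ p.2}.indicator
          (fun p => (diagramMult M p.1 p.2 : ENNReal)) p) +
        ∑ b ∈ G, (Set.Iic s).indicator (fun b => (diagramMultTop M b : ENNReal)) b := by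
        push_cast
        congr 1
        · exact Finset.sum_congr rfl fun p hp => (Set.indicator_of_mem
            (show p ∈ {p : ℝ × ℝ | p.1 ≤ s ∧ t ≤ p.2} from hF p hp)
            (fun p : ℝ × ℝ => (diagramMult M p.1 p.2 : ENNReal))).symm
        · exact Finset.sum_congr rfl fun p hp => (Set.indicator_of_mem
            (Set.mem_Iic.2 (hG p hp)) (fun b => (diagramMultTop M b : ENNReal))).symm
    _ ≤ _ := add_le_add (ENNReal.sum_le_tsum _) (ENNReal.sum_le_tsum _)

end Covering

/-! ### Total persistence as an integral over levels -/

section Integral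

open MeasureTheory

/-- A possibly uncountable sum of nonnegative functions whose integrals have a finite sum can be
integrated termwise, since only countably many terms are not zero. -/
theorem lintegral_tsum_le_tsum {α Ω : Type*} [MeasurableSpace Ω] {μ : Measure Ω}
    {h : α → Ω → ENNReal} (hm : ∀ a, Measurable (h a)) {g : α → ENNReal}
    (hg : ∑' a, g a ≠ ⊤) (hle : ∀ a, ∫⁻ x, h a x ∂μ ≤ g a) (h0 : ∀ a, g a = 0 → h a = 0) :
    ∫⁻ x, ∑' a, h a x ∂μ ≤ ∑' a, g a := by
  have hc : Countable (Function.support g) := Summable.countable_support_ennreal hg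
  have e : ∀ x, ∑' a, h a x = ∑' a : Function.support g, h a.1 x := fun x =>
    (tsum_subtype_eq_of_support_subset fun a ha => by
      intro hga
      exact ha (congrFun (h0 a hga) x)).symm
  simp_rw [e]
  rw [lintegral_tsum (f := fun (a : Function.support g) x => h a.1 x)
    fun a => (hm a.1).aemeasurable]
  calc ∑' a : Function.support g, ∫⁻ x, h a x ∂μ ≤ ∑' a : Function.support g, g a :=
        ENNReal.tsum_le_tsum fun a => hle a
    _ ≤ ∑' a, g a := ENNReal.tsum_comp_le_tsum_of_injective Subtype.val_injective g

theorem ENNReal.tsum_sumElim {α β : Type*} (f : α → ENNReal) (g : β → ENNReal) :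
    ∑' x, Sum.elim f g x = ∑' a, f a + ∑' b, g b :=
  (HasSum.sum ENNReal.summable.hasSum ENNReal.summable.hasSum).tsum_eq

variable {K : Type u} [Field K] {M : ℝ ⥤ ModuleCat.{u} K}

/-- The persistence of a diagram point is the length of the set of levels at which the feature is
alive, so the total persistence dominates the integral of any lower bound `N` for the ranks near
the level `t`. -/
theorem QTame.lintegral_le_clippedPersistence (hM : QTame M)
    (h0 : ∀ x y : ℝ, x < 0 → persistentRank M x y = 0)
    (h1 : ∀ x y z : ℝ, x ≤ y → 1 ≤ y → y ≤ z → persistentRank M x y = persistentRank M x z)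
    {top : ℝ} {N : ℝ → ENNReal}
    (hN : ∀ᵐ t : ℝ, t < top → ∃ δ : ℝ, 0 < δ ∧ N t ≤ persistentRank M (t - δ) (t + δ)) :
    ∫⁻ t in Set.Iio top, N t ≤ clippedPersistence M top := by
  by_cases hfin : clippedPersistence M top = ⊤
  · rw [hfin]; exact le_top
  rw [clippedPersistence, ENNReal.add_eq_top, not_or] at hfin
  set A : ℝ × ℝ → ℝ → ENNReal := fun p =>
    (Set.Ico p.1 p.2).indicator fun _ => (diagramMult M p.1 p.2 : ENNReal) with hA
  set B : ℝ → ℝ → ENNReal := fun b =>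
    (Set.Ico b top).indicator fun _ => (diagramMultTop M b : ENNReal) with hB
  have hAm : ∀ p, Measurable (A p) := fun p => measurable_const.indicator measurableSet_Ico
  have hBm : ∀ p, Measurable (B p) := fun p => measurable_const.indicator measurableSet_Ico
  have iA : ∀ p, ∫⁻ t, A p t = (diagramMult M p.1 p.2 : ENNReal) * ENNReal.ofReal (p.2 - p.1) :=
    fun p => by
      rw [hA, lintegral_indicator_const measurableSet_Ico, Real.volume_Ico]
  have iB : ∀ b, ∫⁻ t, B b t = (diagramMultTop M b : ENNReal) * ENNReal.ofReal (top - b) :=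
    fun p => by
      rw [hB, lintegral_indicator_const measurableSet_Ico, Real.volume_Ico]
  have zA : ∀ p, (diagramMult M p.1 p.2 : ENNReal) * ENNReal.ofReal (p.2 - p.1) = 0 →
      A p = 0 := fun p hp => by
    rcases mul_eq_zero.1 hp with h | h
    · simp only [hA, h]; exact Set.indicator_zero _ _
    · rw [ENNReal.ofReal_eq_zero, sub_nonpos] at h
      simp only [hA, Set.Ico_eq_empty_of_le h]; exact Set.indicator_empty _
  have zB : ∀ b, (diagramMultTop M b : ENNReal) * ENNReal.ofReal (top - b) = 0 →
      B b = 0 := fun p hp => by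
    rcases mul_eq_zero.1 hp with h | h
    · simp only [hB, h]; exact Set.indicator_zero _ _
    · rw [ENNReal.ofReal_eq_zero, sub_nonpos] at h
      simp only [hB, Set.Ico_eq_empty_of_le h]; exact Set.indicator_empty _
  have hpt : ∀ᵐ t ∂(volume.restrict (Set.Iio top)),
      N t ≤ ∑' x : (ℝ × ℝ) ⊕ ℝ, Sum.elim A B x t := by
    refine (ae_restrict_iff' measurableSet_Iio).2 (hN.mono fun t ht htop => ?_)
    obtain ⟨δ, hδ, hle⟩ := ht htop
    refine hle.trans ((hM.persistentRank_le_tsum h0 h1 (by linarith)).trans ?_)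
    have e : ∑' x : (ℝ × ℝ) ⊕ ℝ, Sum.elim A B x t = ∑' p, A p t + ∑' b, B b t := by
      rw [← ENNReal.tsum_sumElim]
      exact tsum_congr (by rintro (p | b) <;> rfl)
    rw [e]
    refine add_le_add (ENNReal.tsum_le_tsum fun p => ?_) (ENNReal.tsum_le_tsum fun b => ?_)
    · refine Set.indicator_le (g := fun p => A p t) (fun p hp => ?_) p
      have : t ∈ Set.Ico p.1 p.2 := ⟨by linarith [hp.1], by linarith [hp.2]⟩
      exact (Set.indicator_of_mem this (fun _ => (diagramMult M p.1 p.2 : ENNReal))).ge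
    · refine Set.indicator_le (g := fun b => B b t) (fun p hp => ?_) b
      have : t ∈ Set.Ico p top := ⟨by linarith [Set.mem_Iic.1 hp], htop⟩
      exact (Set.indicator_of_mem this (fun _ => (diagramMultTop M p : ENNReal))).ge
  refine (lintegral_mono_ae hpt).trans ((setLIntegral_le_lintegral _ _).trans ?_)
  have hclip : clippedPersistence M top = ∑' x : (ℝ × ℝ) ⊕ ℝ, Sum.elim
      (fun p : ℝ × ℝ => (diagramMult M p.1 p.2 : ENNReal) * ENNReal.ofReal (p.2 - p.1))
      (fun b : ℝ => (diagramMultTop M b : ENNReal) * ENNReal.ofReal (top - b)) x := by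
    rw [ENNReal.tsum_sumElim]; rfl
  rw [hclip]
  refine lintegral_tsum_le_tsum ?_ ?_ ?_ ?_
  · rintro (p | b)
    exacts [hAm p, hBm b]
  · rw [← hclip, clippedPersistence, Ne, ENNReal.add_eq_top, not_or]
    exact hfin
  · rintro (p | b)
    exacts [(iA p).le, (iB b).le]
  · rintro (p | b)
    exacts [zA p, zB b]

end Integral

/-! ### Singular homology of discrete and of contractible spaces -/

section Homology

open AlgebraicTopology Limits

variable (K : Type u) [Field K]

/-- Singular homology with coefficients in the field `K`. -/
noncomputable abbrev homologyFunctor (k : ℕ) : TopCat.{0} ⥤ ModuleCat.{u} K :=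
  (singularHomologyFunctor (ModuleCat.{u} K) k).obj (ModuleCat.of K K)

theorem finrank_homologyFunctor_zero_of_totallyDisconnected (X : TopCat.{0}) [Finite X]
    [TotallyDisconnectedSpace X] :
    Module.finrank K ((homologyFunctor K 0).obj X) = Nat.card X ∧
      FiniteDimensional K ((homologyFunctor K 0).obj X) := by
  classical
  have := Fintype.ofFinite X
  have e := (singularHomologyFunctorZeroOfTotallyDisconnectedSpace (ModuleCat.{u} K)
    (ModuleCat.of K K) X ≪≫ ModuleCat.coprodIsoDirectSum _).toLinearEquiv
  have e' := e.trans (DirectSum.linearEquivFunOnFintype K X fun _ => K)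
  refine ⟨?_, Module.Finite.equiv e'.symm⟩
  rw [e'.finrank_eq, Module.finrank_fintype_fun_eq_card, Nat.card_eq_fintype_card]

theorem homologyFunctor_subsingleton_of_totallyDisconnected {k : ℕ} (hk : k ≠ 0) (X : TopCat.{0})
    [TotallyDisconnectedSpace X] : Subsingleton ((homologyFunctor K k).obj X) :=
  ModuleCat.subsingleton_of_isZero
    (isZero_singularHomologyFunctor_of_totallyDisconnectedSpace _ k _ X hk)

theorem homologyFunctor_map_eq_of_homotopic {k : ℕ} {X Y : TopCat.{0}} {f g : X ⟶ Y}
    (h : ContinuousMap.Homotopic f.hom g.hom) :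
    (homologyFunctor K k).map f = (homologyFunctor K k).map g :=
  TopCat.Homotopy.congr_homologyMap_singularChainComplexFunctor h.some (ModuleCat.of K K) k

theorem homotopic_of_contractibleSpace {X Y : Type*} [TopologicalSpace X] [TopologicalSpace Y]
    [ContractibleSpace Y] (f g : C(X, Y)) : ContinuousMap.Homotopic f g := by
  obtain ⟨y, hy⟩ := id_nullhomotopic Y
  exact ((hy.comp (.refl f)).trans (hy.comp (.refl g)).symm)

/-- Any map between contractible spaces induces an isomorphism on homology. -/
theorem bijective_homologyFunctor_map (k : ℕ) {X Y : TopCat.{0}} [ContractibleSpace X]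
    [ContractibleSpace Y] (f : X ⟶ Y) :
    Function.Bijective ((homologyFunctor K k).map f).hom := by
  obtain ⟨x⟩ := (inferInstance : Nonempty X)
  let g : Y ⟶ X := TopCat.ofHom (ContinuousMap.const Y x)
  have h1 : (homologyFunctor K k).map f ≫ (homologyFunctor K k).map g = 𝟙 _ := by
    rw [← Functor.map_comp, ← CategoryTheory.Functor.map_id]
    exact homologyFunctor_map_eq_of_homotopic K (homotopic_of_contractibleSpace _ _)
  have h2 : (homologyFunctor K k).map g ≫ (homologyFunctor K k).map f = 𝟙 _ := by
    rw [← Functor.map_comp, ← CategoryTheory.Functor.map_id]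
    exact homologyFunctor_map_eq_of_homotopic K (homotopic_of_contractibleSpace _ _)
  refine ⟨Function.LeftInverse.injective (g := ((homologyFunctor K k).map g).hom) fun x => ?_,
    Function.RightInverse.surjective (g := ((homologyFunctor K k).map g).hom) fun x => ?_⟩
  · exact congrArg (fun φ => φ.hom x) h1
  · exact congrArg (fun φ => φ.hom x) h2

theorem finrank_homologyFunctor_of_contractible (k : ℕ) (X : TopCat.{0}) [ContractibleSpace X] :
    Module.finrank K ((homologyFunctor K k).obj X) = (if k = 0 then 1 else 0) ∧
      FiniteDimensional K ((homologyFunctor K k).obj X) := by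
  let P : TopCat.{0} := TopCat.of Unit
  have : ContractibleSpace P := inferInstanceAs (ContractibleSpace Unit)
  have : TotallyDisconnectedSpace P := inferInstanceAs (TotallyDisconnectedSpace Unit)
  have : Finite P := inferInstanceAs (Finite Unit)
  let f : X ⟶ P := TopCat.ofHom (ContinuousMap.const X ())
  let e := LinearEquiv.ofBijective _ (bijective_homologyFunctor_map K k f)
  rw [e.finrank_eq]
  split_ifs with hk
  · subst hk
    obtain ⟨h1, h2⟩ := finrank_homologyFunctor_zero_of_totallyDisconnected K P
    exact ⟨h1.trans (Nat.card_unique (α := Unit)), Module.Finite.equiv e.symm⟩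
  · have := homologyFunctor_subsingleton_of_totallyDisconnected K hk P
    exact ⟨Module.finrank_zero_of_subsingleton, Module.Finite.equiv e.symm⟩

theorem homologyFunctor_subsingleton_of_isEmpty (k : ℕ) (X : TopCat.{0}) [IsEmpty X] :
    Subsingleton ((homologyFunctor K k).obj X) := by
  have : TotallyDisconnectedSpace X := inferInstance
  by_cases hk : k = 0
  · subst hk
    obtain ⟨h1, h2⟩ := finrank_homologyFunctor_zero_of_totallyDisconnected K X
    rw [Nat.card_of_isEmpty] at h1
    exact Module.finrank_zero_iff.1 h1
  · exact homologyFunctor_subsingleton_of_totallyDisconnected K hk X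

/-- If a finite set `I` of points of `X` is mapped injectively to a discrete quotient of `Y`, then
these points lie in different path components of `Y`, and the map induced by `X → Y` on `H₀` has
rank at least `|I|`. -/
theorem card_le_finrank_range_homologyFunctor_zero_map {X Y : TopCat.{0}} (φ : X ⟶ Y)
    [FiniteDimensional K (LinearMap.range ((homologyFunctor K 0).map φ).hom)]
    {I Z : Type} [Finite I] [TopologicalSpace I] [DiscreteTopology I] [TopologicalSpace Z]
    [DiscreteTopology Z] (p : C(I, X)) (q : C(Y, Z))
    (hinj : Function.Injective fun i => q (φ.hom (p i))) :
    Nat.card I ≤ Module.finrank K (LinearMap.range ((homologyFunctor K 0).map φ).hom) := by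
  cases isEmpty_or_nonempty I with
  | inl h => rw [Nat.card_of_isEmpty]; exact Nat.zero_le _
  | inr h =>
    let J : TopCat.{0} := TopCat.of I
    let W : TopCat.{0} := TopCat.of Z
    have : TotallyDisconnectedSpace J := inferInstanceAs (TotallyDisconnectedSpace I)
    have : Finite J := inferInstanceAs (Finite I)
    let P : J ⟶ X := TopCat.ofHom p
    let Q : Y ⟶ W := TopCat.ofHom q
    let ρ : W ⟶ J := TopCat.ofHom
      ⟨Function.invFun fun i => q (φ.hom (p i)), continuous_of_discreteTopology⟩
    have hid : P ≫ φ ≫ Q ≫ ρ = 𝟙 J := by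
      ext i
      exact Function.leftInverse_invFun hinj i
    have hH : (homologyFunctor K 0).map P ≫ (homologyFunctor K 0).map φ ≫
        (homologyFunctor K 0).map (Q ≫ ρ) = 𝟙 _ := by
      rw [← Functor.map_comp, ← Functor.map_comp, ← CategoryTheory.Functor.map_id, hid]
    have hI : Function.Injective (((homologyFunctor K 0).map φ).hom ∘ₗ
        ((homologyFunctor K 0).map P).hom) :=
      Function.LeftInverse.injective (g := ((homologyFunctor K 0).map (Q ≫ ρ)).hom)
        fun x => congrArg (fun φ => φ.hom x) hH
    rw [show Nat.card I = _ from (finrank_homologyFunctor_zero_of_totallyDisconnected K J).1.symm,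
      ← LinearMap.finrank_range_of_inj hI]
    exact Submodule.finrank_mono (LinearMap.range_comp_le_range _ _)

end Homology

/-! ### Lower bounds for the total persistence -/

section LowerBound

open MeasureTheory

variable (K : Type u) [Field K] {X : Type} [TopologicalSpace X] {f : X → ℝ}

theorem persistentRank_sublevelHomology_of_isEmpty {k : ℕ} {s t : ℝ} (hs : ∀ x, s < f x) :
    persistentRank (sublevelHomology K f k) s t = 0 := by
  by_cases h : s ≤ t
  · have : IsEmpty ((sublevelFiltration f).obj s) := ⟨fun x => absurd x.2 (not_le.2 (hs x.1))⟩
    have : Subsingleton ((sublevelHomology K f k).obj s) :=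
      homologyFunctor_subsingleton_of_isEmpty K k ((sublevelFiltration f).obj s)
    rw [persistentRank_of_le h]
    have := (LinearMap.surjective_rangeRestrict
      ((sublevelHomology K f k).map (homOfLE h)).hom).subsingleton
    exact Module.finrank_zero_of_subsingleton
  · exact dif_neg h

theorem persistentRank_sublevelHomology_of_forall_le {k : ℕ} {s t u : ℝ} (hst : s ≤ t)
    (htu : t ≤ u) (ht : ∀ x, f x ≤ t) :
    persistentRank (sublevelHomology K f k) s t = persistentRank (sublevelHomology K f k) s u := by
  rw [persistentRank_of_le hst, persistentRank_of_le (hst.trans htu), map_homOfLE_comp hst htu,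
    LinearMap.range_comp]
  let φ := (sublevelFiltration f).map (homOfLE htu)
  let ψ : (sublevelFiltration f).obj u ⟶ (sublevelFiltration f).obj t := TopCat.ofHom
    ⟨fun x => ⟨x.1, ht x.1⟩, continuous_subtype_val.subtype_mk _⟩
  have h : (homologyFunctor K k).map φ ≫ (homologyFunctor K k).map ψ = 𝟙 _ := by
    rw [← Functor.map_comp, ← CategoryTheory.Functor.map_id]
    rfl
  have hinj : Function.Injective ((sublevelHomology K f k).map (homOfLE htu)).hom :=
    Function.LeftInverse.injective (g := ((homologyFunctor K k).map ψ).hom)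
      fun x => congrArg (fun φ => φ.hom x) h
  exact (Submodule.equivMapOfInjective _ hinj _).finrank_eq

variable {K}

theorem card_le_persistentRank (hf : QTame (sublevelHomology K f 0)) {s t : ℝ} (hst : s < t)
    {I Z : Type} [Finite I] [TopologicalSpace I] [DiscreteTopology I] [TopologicalSpace Z]
    [DiscreteTopology Z] (p : I → X) (hp : ∀ i, f (p i) ≤ s) (q : C({x : X // f x ≤ t}, Z))
    (hinj : Function.Injective fun i => q ⟨p i, (hp i).trans hst.le⟩) :
    Nat.card I ≤ persistentRank (sublevelHomology K f 0) s t := by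
  rw [persistentRank_of_le hst.le]
  have : FiniteDimensional K (LinearMap.range ((homologyFunctor K 0).map
    ((sublevelFiltration f).map (homOfLE hst.le))).hom) := hf hst
  exact card_le_finrank_range_homologyFunctor_zero_map K
    ((sublevelFiltration f).map (homOfLE hst.le))
    ⟨fun i => ⟨p i, hp i⟩, continuous_of_discreteTopology⟩ q hinj

theorem lintegral_le_clippedPersistence_sublevelHomology (h0 : ∀ x, 0 ≤ f x)
    (h1 : ∀ x, f x ≤ 1) {k : ℕ} (hf : QTame (sublevelHomology K f k)) {top : ℝ}
    {N : ℝ → ENNReal}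
    (hN : ∀ᵐ t : ℝ, t < top → ∃ δ : ℝ, 0 < δ ∧
      N t ≤ persistentRank (sublevelHomology K f k) (t - δ) (t + δ)) :
    ∫⁻ t in Set.Iio top, N t ≤ clippedPersistence (sublevelHomology K f k) top :=
  hf.lintegral_le_clippedPersistence
    (fun _ _ hx => persistentRank_sublevelHomology_of_isEmpty K fun z => hx.trans_le (h0 z))
    (fun _ _ _ hxy hy hyz => persistentRank_sublevelHomology_of_forall_le K hxy hyz
      fun z => (h1 z).trans hy) hN

/-- The component of the infimum never dies, so the total persistence is at least the oscillation
of the function. -/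
theorem ofReal_sub_le_clippedPersistence (h0 : ∀ x, 0 ≤ f x) (h1 : ∀ x, f x ≤ 1)
    (hf : QTame (sublevelHomology K f 0)) (x y : X) :
    ENNReal.ofReal (f y - f x) ≤
      clippedPersistence (sublevelHomology K f 0) (sSup (Set.range f)) := by
  have hle : f y ≤ sSup (Set.range f) :=
    le_csSup ⟨1, by rintro _ ⟨z, rfl⟩; exact h1 z⟩ ⟨y, rfl⟩
  have key := lintegral_le_clippedPersistence_sublevelHomology h0 h1 hf
    (top := sSup (Set.range f)) (N := (Set.Ioi (f x)).indicator 1)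
    (Filter.Eventually.of_forall fun t _ => by
      by_cases ht : f x < t
      · refine ⟨(t - f x) / 2, by linarith, ?_⟩
        rw [Set.indicator_of_mem (Set.mem_Ioi.2 ht), Pi.one_apply]
        have := card_le_persistentRank hf (s := t - (t - f x) / 2) (t := t + (t - f x) / 2)
          (by linarith) (I := Unit) (Z := Unit) (fun _ => x) (fun _ => by linarith)
          ⟨fun _ => (), continuous_const⟩ (fun _ _ _ => rfl)
        rw [Nat.card_unique] at this
        exact_mod_cast this
      · exact ⟨1, one_pos, by rw [Set.indicator_of_notMem (mt Set.mem_Ioi.1 ht)]; exact zero_le⟩)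
  refine le_trans ?_ key
  rw [lintegral_indicator_one measurableSet_Ioi, Measure.restrict_apply measurableSet_Ioi,
    ← Real.volume_Ioo]
  exact measure_mono fun z hz => ⟨hz.1, hz.2.trans_le hle⟩

open scoped Classical in
/-- In a sequence of truth values, the number of changes is at most twice the number of maximal
blocks of true values; the latter are counted by their first elements. -/
theorem sum_changes_le (β : ℕ → Prop) (n : ℕ) :
    (∑ i ∈ Finset.range n, if (β i ↔ β (i + 1)) then 0 else 1) + (if β n then 1 else 0) ≤
      2 * ((Finset.range (n + 1)).filter fun i => β i ∧ (i = 0 ∨ ¬ β (i - 1))).card := by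
  rw [Finset.card_filter]
  induction n with
  | zero => by_cases h : β 0 <;> simp [Finset.filter_singleton, h]
  | succ n ih =>
    rw [Finset.sum_range_succ, Finset.sum_range_succ _ (n + 1)]
    by_cases h1 : β n <;> by_cases h2 : β (n + 1) <;> simp [h1, h2] at ih ⊢ <;> omega

end LowerBound

/-! ### Variation of functions on the interval -/

section Variation

open MeasureTheory

variable {K : Type u} [Field K] {f : UnitCube 1 → ℝ}

open scoped Classical in
/-- At a level `t` that avoids the values of `f` at the points `x 0 < x 1 < ⋯ < x n` of the
interval, the blocks of consecutive points below the level lie in different components. -/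
theorem card_blocks_le_persistentRank (hf : QTame (sublevelHomology K f 0))
    {n : ℕ} {x : ℕ → UnitCube 1} (hx : ∀ i j, i < j → j ≤ n → x i 0 < x j 0) {s t : ℝ}
    (hst : s < t) (ht : ∀ i ≤ n, f (x i) ≤ s ∨ t < f (x i)) :
    ((Finset.range (n + 1)).filter fun i => f (x i) ≤ s ∧ (i = 0 ∨ ¬ f (x (i - 1)) ≤ s)).card ≤
      persistentRank (sublevelHomology K f 0) s t := by
  set I := (Finset.range (n + 1)).filter fun i => f (x i) ≤ s ∧ (i = 0 ∨ ¬ f (x (i - 1)) ≤ s)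
    with hI
  set J := (Finset.range (n + 1)).filter fun j => t < f (x j) with hJ
  have hmono : ∀ i j, i ≤ j → j ≤ n → x i 0 ≤ x j 0 := fun i j hij hj => by
    rcases hij.eq_or_lt with rfl | h
    exacts [le_rfl, (hx i j h hj).le]
  -- the number of points above the level to the left of `y` is locally constant
  let q : C({y : UnitCube 1 // f y ≤ t}, ℕ) :=
    ⟨fun y => ∑ j ∈ J, if x j 0 < y.1 0 then 1 else 0, by
      refine continuous_finsetSum _ fun j hj => Continuous.if (fun y hy => ?_)
        continuous_const continuous_const
      have hc : Continuous fun y : {y : UnitCube 1 // f y ≤ t} => y.1 0 :=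
        (continuous_apply 0).comp continuous_subtype_val
      have h := frontier_lt_subset_eq continuous_const hc hy
      have hxy : x j = y.1 := by
        ext i
        rw [Subsingleton.elim i 0]
        exact congrArg Subtype.val h
      exact absurd y.2 (not_le.2 (hxy ▸ (Finset.mem_filter.1 hj).2))⟩
  have hlt : ∀ i ∈ I, ∀ j ∈ I, i < j → (∑ m ∈ J, if x m 0 < x i 0 then 1 else 0) <
      ∑ m ∈ J, if x m 0 < x j 0 then 1 else 0 := fun i hi j hj hij => by
    have hi' := Finset.mem_filter.1 hi
    have hj' := Finset.mem_filter.1 hj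
    have hjn : j ≤ n := Nat.lt_succ_iff.1 (Finset.mem_range.1 hj'.1)
    have hj1 : ¬ f (x (j - 1)) ≤ s := by
      rcases hj'.2.2 with h | h
      · omega
      · exact h
    refine Finset.sum_lt_sum (fun m _ => ?_) ⟨j - 1, ?_, ?_⟩
    · split_ifs with h1 h2
      · exact le_rfl
      · exact absurd (h1.trans (hx i j hij hjn)) h2
      · exact Nat.zero_le _
      · exact le_rfl
    · exact Finset.mem_filter.2 ⟨Finset.mem_range.2 (by omega),
        (ht (j - 1) (by omega)).resolve_left hj1⟩
    · rw [if_neg (not_lt.2 (hmono i (j - 1) (by omega) (by omega))),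
        if_pos (hx (j - 1) j (by omega) hjn)]
      exact one_pos
  have := card_le_persistentRank hf hst (I := I) (Z := ℕ) (fun i => x i)
    (fun i => (Finset.mem_filter.1 i.2).2.1) q (fun i j hij => by
      rcases lt_trichotomy i.1 j.1 with h | h | h
      · exact absurd hij (hlt i i.2 j j.2 h).ne
      · exact Subtype.ext h
      · exact absurd hij (hlt j j.2 i i.2 h).ne')
  rwa [Nat.card_eq_fintype_card, Fintype.card_coe] at this

open scoped Classical in
/-- On the interval, the total persistence is at least half the variation of the function along
any finite sequence of points, since each block of points below a level is bounded by at most two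
crossings of the level. -/
theorem sum_abs_sub_le_clippedPersistence (h0 : ∀ x, 0 ≤ f x)
    (h1 : ∀ x, f x ≤ 1) (hf : QTame (sublevelHomology K f 0))
    {n : ℕ} {x : ℕ → UnitCube 1} (hx : ∀ i j, i < j → j ≤ n → x i 0 < x j 0) :
    ENNReal.ofReal (∑ i ∈ Finset.range n, |f (x (i + 1)) - f (x i)| / 2) ≤
      clippedPersistence (sublevelHomology K f 0) (sSup (Set.range f)) := by
  have hle : ∀ y, f y ≤ sSup (Set.range f) := fun y =>
    le_csSup ⟨1, by rintro _ ⟨z, rfl⟩; exact h1 z⟩ ⟨y, rfl⟩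
  set J : ℕ → Set ℝ := fun i =>
    Set.Ioo (min (f (x i)) (f (x (i + 1)))) (max (f (x i)) (f (x (i + 1)))) with hJ
  have hfin : (((fun i => f (x i)) '' Set.Iic n)).Finite := (Set.finite_Iic n).image _
  -- almost every level `t` avoids the finitely many values `f (x i)`, and stays away from them
  have key := lintegral_le_clippedPersistence_sublevelHomology h0 h1 hf
    (top := sSup (Set.range f)) (N := fun t => ∑ i ∈ Finset.range n,
      (J i).indicator (fun _ => ENNReal.ofReal (1 / 2)) t)
    ((hfin.countable.ae_notMem volume).mono fun t ht _ => by
      obtain ⟨δ, hδ, hball⟩ := Metric.isOpen_iff.1 hfin.isClosed.isOpen_compl t ht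
      have hfar : ∀ i ≤ n, δ ≤ |f (x i) - t| := fun i hi => by
        by_contra! h
        exact hball (Metric.mem_ball.2 (by rwa [Real.dist_eq])) ⟨i, hi, rfl⟩
      have hiff : ∀ i ≤ n, (f (x i) ≤ t - δ / 2 ∧ f (x i) < t) ∨
          (t + δ / 2 < f (x i) ∧ t < f (x i)) := fun i hi => by
        rcases le_abs.1 (hfar i hi) with h | h
        · right; constructor <;> linarith
        · left; constructor <;> linarith
      refine ⟨δ / 2, by linarith, ?_⟩
      have hcard := card_blocks_le_persistentRank hf hx (s := t - δ / 2) (t := t + δ / 2)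
        (by linarith) fun i hi => (hiff i hi).imp And.left And.left
      have hch := sum_changes_le (fun i => f (x i) ≤ t - δ / 2) n
      have hsum : ∑ i ∈ Finset.range n, (J i).indicator (fun _ => ENNReal.ofReal (1 / 2)) t ≤
          ENNReal.ofReal (1 / 2) * ((∑ i ∈ Finset.range n,
            if (f (x i) ≤ t - δ / 2 ↔ f (x (i + 1)) ≤ t - δ / 2) then 0 else 1 : ℕ) :
              ENNReal) := by
        push_cast
        rw [Finset.mul_sum]
        refine Finset.sum_le_sum fun i hi => ?_
        rw [Finset.mem_range] at hi
        by_cases hti : t ∈ J i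
        · rw [Set.indicator_of_mem hti, if_neg, mul_one]
          intro hcon
          have a1 := min_lt_iff.1 hti.1
          have a2 := lt_max_iff.1 hti.2
          rcases hiff i hi.le with b1 | b1 <;> rcases hiff (i + 1) hi with b2 | b2
          · rcases a2 with a2 | a2 <;> linarith [b1.2, b2.2]
          · linarith [hcon.1 b1.1, b2.1]
          · linarith [hcon.2 b2.1, b1.1]
          · rcases a1 with a1 | a1 <;> linarith [b1.2, b2.2]
        · rw [Set.indicator_of_notMem hti]
          exact zero_le
      refine hsum.trans ?_
      calc _ ≤ ENNReal.ofReal (1 / 2) *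
            ((2 * persistentRank (sublevelHomology K f 0) (t - δ / 2) (t + δ / 2) : ℕ) :
              ENNReal) := by
            gcongr
            omega
        _ = _ := by
            push_cast
            rw [← mul_assoc, ← ENNReal.ofReal_ofNat, ← ENNReal.ofReal_mul (by norm_num)]
            norm_num)
  refine le_trans (le_of_eq ?_) key
  rw [lintegral_finsetSum _ fun i _ => measurable_const.indicator measurableSet_Ioo,
    ENNReal.ofReal_sum_of_nonneg fun i _ => by positivity]
  refine Finset.sum_congr rfl fun i _ => ?_
  rw [lintegral_indicator_const measurableSet_Ioo, Measure.restrict_apply measurableSet_Ioo,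
    Set.inter_eq_left.2 fun z hz => hz.2.trans_le (max_le (hle _) (hle _)), Real.volume_Ioo,
    max_sub_min_eq_abs, ← ENNReal.ofReal_mul (by norm_num)]
  congr 1
  ring

end Variation

/-! ### Functions with contractible sublevel sets -/

section UpperBound

variable (K : Type u) [Field K] {X : Type} [TopologicalSpace X] {f : X → ℝ}

theorem qTame_of_contractible_sublevels
    (hc : ∀ t, (∃ x, f x ≤ t) → ContractibleSpace {x : X // f x ≤ t}) (k : ℕ) :
    QTame (sublevelHomology K f k) := by
  intro s t hst
  have : FiniteDimensional K ((sublevelHomology K f k).obj s) := by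
    by_cases hs : ∃ x, f x ≤ s
    · have : ContractibleSpace ((sublevelFiltration f).obj s) := hc s hs
      exact (finrank_homologyFunctor_of_contractible K k ((sublevelFiltration f).obj s)).2
    · push Not at hs
      have : IsEmpty ((sublevelFiltration f).obj s) :=
        ⟨fun x => absurd x.2 (not_le.2 (hs x.1))⟩
      have : Subsingleton ((sublevelHomology K f k).obj s) :=
        homologyFunctor_subsingleton_of_isEmpty K k ((sublevelFiltration f).obj s)
      infer_instance
  infer_instance

open scoped Classical in
theorem persistentRank_of_contractible_sublevels
    (hc : ∀ t, (∃ x, f x ≤ t) → ContractibleSpace {x : X // f x ≤ t}) (k : ℕ) {s t : ℝ}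
    (hst : s ≤ t) : persistentRank (sublevelHomology K f k) s t =
      if (∃ x, f x ≤ s) ∧ k = 0 then 1 else 0 := by
  by_cases hs : ∃ x, f x ≤ s
  · have : ContractibleSpace ((sublevelFiltration f).obj s) := hc s hs
    have : ContractibleSpace ((sublevelFiltration f).obj t) :=
      hc t (hs.imp fun _ hx => hx.trans hst)
    have htop : LinearMap.range ((sublevelHomology K f k).map (homOfLE hst)).hom = ⊤ :=
      LinearMap.range_eq_top.2 (bijective_homologyFunctor_map K k
        ((sublevelFiltration f).map (homOfLE hst))).2
    rw [persistentRank_of_le hst, htop, finrank_top]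
    refine (finrank_homologyFunctor_of_contractible K k ((sublevelFiltration f).obj t)).1.trans ?_
    simp [hs]
  · rw [if_neg fun h => hs h.1]
    push Not at hs
    exact persistentRank_sublevelHomology_of_isEmpty K hs

/-- If all nonempty sublevel sets are contractible, the only diagram point is `(inf f, ∞)` in
degree `0`. -/
theorem totalPersistence_le_of_contractible_sublevels [Nonempty X]
    (hb : BddBelow (Set.range f))
    (hc : ∀ t, (∃ x, f x ≤ t) → ContractibleSpace {x : X // f x ≤ t}) :
    totalPersistence K f ≤ ENNReal.ofReal (sSup (Set.range f) - sInf (Set.range f)) := by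
  classical
  have hr := fun k s t hst => persistentRank_of_contractible_sublevels K hc k (s := s) (t := t) hst
  have hfin : ∀ k b d, diagramMult (sublevelHomology K f k) b d = 0 := fun k b d => by
    by_cases hbd : b < d
    · obtain ⟨ε, hε, hε', h⟩ := exists_featureCount_eq_diagramMult (sublevelHomology K f k) hbd
      rw [← h, featureCount, hr k _ _ hε'.le, hr k _ _ (by linarith : b + ε ≤ d + ε),
        hr k _ _ (by linarith : b - ε ≤ d - ε), hr k _ _ (by linarith : b - ε ≤ d + ε)]
      omega
    · have : IsEmpty {ε : ℝ // 0 < ε ∧ b + ε < d - ε} :=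
        ⟨fun ε => hbd (by linarith [ε.2.1, ε.2.2])⟩
      rw [diagramMult, iInf_of_isEmpty, Nat.sInf_empty]
  have hle : ∀ k b (ε : ℝ), 0 < ε → diagramMultTop (sublevelHomology K f k) b ≤
      (if (∃ x, f x ≤ b + ε) ∧ k = 0 then 1 else 0) -
        (if (∃ x, f x ≤ b - ε) ∧ k = 0 then 1 else 0) := fun k b ε hε => by
    refine (ciInf_le (OrderBot.bddBelow _) ⟨(ε, b + ε + 1), hε, by simp⟩).trans ?_
    dsimp only
    rw [hr k _ _ (by linarith), hr k _ _ (by linarith)]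
  have hk : ∀ k ≠ 0, ∀ b, diagramMultTop (sublevelHomology K f k) b = 0 := fun k hk b => by
    simpa [hk] using hle k b 1 one_pos
  have h0 : ∀ b, b ≠ sInf (Set.range f) → diagramMultTop (sublevelHomology K f 0) b = 0 :=
    fun b hbm => by
      rcases hbm.lt_or_gt with h | h
      · have := hle 0 b ((sInf (Set.range f) - b) / 2) (by linarith)
        rw [if_neg] at this
        · omega
        · rintro ⟨⟨x, hx⟩, -⟩
          linarith [csInf_le hb ⟨x, rfl⟩]
      · obtain ⟨_, ⟨x, rfl⟩, hx⟩ := exists_lt_of_csInf_lt (Set.range_nonempty f) h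
        have := hle 0 b (b - f x) (by linarith)
        rw [if_pos (c := _ ∧ _) ⟨⟨x, by linarith⟩, rfl⟩,
          if_pos (c := _ ∧ _) ⟨⟨x, by linarith⟩, rfl⟩] at this
        omega
  have h1 : diagramMultTop (sublevelHomology K f 0) (sInf (Set.range f)) ≤ 1 :=
    (hle 0 _ 1 one_pos).trans (by split_ifs <;> omega)
  rw [totalPersistence, tsum_eq_single 0 fun k hk0 => by simp [clippedPersistence, hfin, hk k hk0],
    clippedPersistence]
  simp only [hfin, Nat.cast_zero, zero_mul, tsum_zero, zero_add]
  rw [tsum_eq_single (sInf (Set.range f)) fun b hbm => by simp [h0 b hbm]]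
  calc _ ≤ (1 : ENNReal) * ENNReal.ofReal (sSup (Set.range f) - sInf (Set.range f)) := by
        gcongr
        exact_mod_cast h1
    _ = _ := one_mul _

variable {K} {d : ℕ}

/-- The sublevel sets of a function on the cube `[0,1]^d ⊆ ℝ^d` are convex: each of them is cut out
of the cube by a convex subset of `ℝ^d`. -/
def HasConvexSublevels (f : UnitCube d → ℝ) : Prop :=
  ∀ t, ∃ C : Set (Fin d → ℝ), Convex ℝ C ∧ ∀ x : UnitCube d, f x ≤ t ↔ (fun i => (x i : ℝ)) ∈ C

theorem HasConvexSublevels.contractibleSpace {f : UnitCube d → ℝ} (hf : HasConvexSublevels f)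
    {t : ℝ} (ht : ∃ x, f x ≤ t) : ContractibleSpace {x : UnitCube d // f x ≤ t} := by
  obtain ⟨C, hC, hfC⟩ := hf t
  let D : Set (Fin d → ℝ) := C ∩ Set.univ.pi fun _ => Set.Icc 0 1
  have hD : Convex ℝ D := hC.inter (convex_pi fun _ _ => convex_Icc 0 1)
  let e : {x : UnitCube d // f x ≤ t} ≃ₜ D :=
    { toFun := fun x => ⟨fun i => (x.1 i : ℝ), (hfC x.1).1 x.2, fun i _ => (x.1 i).2⟩
      invFun := fun y => ⟨fun i => ⟨y.1 i, y.2.2 i trivial⟩, (hfC _).2 y.2.1⟩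
      left_inv := fun _ => rfl
      right_inv := fun _ => rfl
      continuous_toFun := by
        refine Continuous.subtype_mk (continuous_pi fun i => ?_) _
        exact continuous_subtype_val.comp ((continuous_apply i).comp continuous_subtype_val)
      continuous_invFun := by
        refine Continuous.subtype_mk (continuous_pi fun i => ?_) _
        exact ((continuous_apply i).comp continuous_subtype_val).subtype_mk _ }
  obtain ⟨x, hx⟩ := ht
  have := hD.contractibleSpace ⟨_, (e ⟨x, hx⟩).2⟩
  exact e.contractibleSpace

/-- Functions with convex sublevel sets and values in `[0, h]` have total persistence at most
`h`. -/
theorem mem_boundedPersistenceClass_of_hasConvexSublevels {f : UnitCube d → unitInterval}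
    (hf : HasConvexSublevels fun x => (f x : ℝ)) {h V : ℝ} (hfh : ∀ x, (f x : ℝ) ≤ h)
    (hV : h ≤ V) : f ∈ boundedPersistenceClass K d V := by
  refine ⟨qTame_of_contractible_sublevels K fun t => hf.contractibleSpace,
    (totalPersistence_le_of_contractible_sublevels K
      ⟨0, by rintro _ ⟨x, rfl⟩; exact (f x).2.1⟩ fun t => hf.contractibleSpace).trans
      (ENNReal.ofReal_le_ofReal ?_)⟩
  have h1 : sSup (Set.range fun x => (f x : ℝ)) ≤ h :=
    csSup_le (Set.range_nonempty _) (by rintro _ ⟨x, rfl⟩; exact hfh x)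
  have h2 : 0 ≤ sInf (Set.range fun x => (f x : ℝ)) :=
    le_csInf (Set.range_nonempty _) (by rintro _ ⟨x, rfl⟩; exact (f x).2.1)
  linarith

theorem hasConvexSublevels_const (c : ℝ) : HasConvexSublevels fun _ : UnitCube d => c := by
  intro t
  by_cases h : c ≤ t
  · exact ⟨Set.univ, convex_univ, fun _ => by simp [h]⟩
  · exact ⟨∅, convex_empty, fun _ => by simp [h]⟩

theorem HasConvexSublevels.finset_sup {ι : Type*} (E : Finset ι)
    {g : ι → UnitCube d → unitInterval} (hg : ∀ i ∈ E, HasConvexSublevels fun x => (g i x : ℝ)) :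
    HasConvexSublevels fun x => ((E.sup fun i => g i x : unitInterval) : ℝ) := by
  classical
  induction E using Finset.induction_on with
  | empty => exact hasConvexSublevels_const _
  | insert i E hi ih =>
    intro t
    obtain ⟨C, hC, h1⟩ := hg i (Finset.mem_insert_self i E) t
    obtain ⟨C', hC', h2⟩ := ih (fun j hj => hg j (Finset.mem_insert_of_mem hj)) t
    refine ⟨C ∩ C', hC.inter hC', fun x => ?_⟩
    rw [Set.mem_inter_iff, ← h1, ← h2]
    dsimp only
    rw [Finset.sup_insert]
    rcases le_total (g i x) (E.sup fun i => g i x) with h | h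
    · rw [sup_eq_right.2 h]
      exact ⟨fun h' => ⟨le_trans (Subtype.coe_le_coe.2 h) h', h'⟩, And.right⟩
    · rw [sup_eq_left.2 h]
      exact ⟨fun h' => ⟨h', le_trans (Subtype.coe_le_coe.2 h) h'⟩, And.left⟩

end UpperBound

/-! ### Separating points on a parabola -/

section Parabola

variable {d : ℕ}

/-- The point `(t, t², 0, …, 0)` of the cube. -/
noncomputable def parabolaPoint (d : ℕ) (t : unitInterval) : UnitCube d :=
  fun i => if i.1 = 0 then t else if i.1 = 1 then t * t else 0

/-- The affine function `h - C (y - 2 t x + t²)` in the first two coordinates `x, y`, truncated to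
the interval `[0, h]`. It is equal to `h - C (u - t)²` (truncated) at the point of parameter `u`
of the parabola `y = x²`. -/
noncomputable def tangentBump (hd : 2 ≤ d) {h : ℝ} (h1 : h ≤ 1) (C t : ℝ)
    (x : UnitCube d) : unitInterval :=
  ⟨max 0 (min h (h - C * ((x ⟨1, hd⟩ : ℝ) - 2 * t * x ⟨0, by omega⟩ + t ^ 2))),
    le_max_left _ _, max_le zero_le_one ((min_le_left _ _).trans h1)⟩

variable (hd : 2 ≤ d) {h : ℝ} (h1 : h ≤ 1) (C t : ℝ)

theorem continuous_tangentBump : Continuous (tangentBump hd h1 C t) := by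
  unfold tangentBump
  fun_prop

theorem tangentBump_le (h0 : 0 ≤ h) (x : UnitCube d) : (tangentBump hd h1 C t x : ℝ) ≤ h :=
  max_le h0 (min_le_left _ _)

theorem tangentBump_parabolaPoint (u : unitInterval) :
    (tangentBump hd h1 C t (parabolaPoint d u) : ℝ) =
      max 0 (min h (h - C * ((u : ℝ) - t) ^ 2)) := by
  simp only [tangentBump, parabolaPoint]
  norm_num
  ring_nf

theorem hasConvexSublevels_tangentBump (h0 : 0 ≤ h) :
    HasConvexSublevels fun x => (tangentBump hd h1 C t x : ℝ) := by
  intro s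
  by_cases hs : s < 0
  · exact ⟨∅, convex_empty, fun x => by
      simpa using hs.trans_le (tangentBump hd h1 C t x).2.1⟩
  by_cases hsh : h ≤ s
  · exact ⟨Set.univ, convex_univ, fun x => by
      simpa using (tangentBump_le hd h1 C t h0 x).trans hsh⟩
  let L : (Fin d → ℝ) →ₗ[ℝ] ℝ := (2 * C * t) • LinearMap.proj ⟨0, by omega⟩ -
    C • LinearMap.proj ⟨1, hd⟩
  refine ⟨{y | L y ≤ s - h + C * t ^ 2}, convex_halfSpace_le L.isLinear _, fun x => ?_⟩
  simp only [tangentBump, max_le_iff, min_le_iff, not_lt.1 hs, hsh, true_and, false_or,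
    Set.mem_ofPred_eq, L, LinearMap.sub_apply, LinearMap.smul_apply, LinearMap.proj_apply,
    smul_eq_mul]
  constructor <;> intro <;> linarith

/-- Arbitrarily many points on a parabola can be separated, with levels `0` and `h`, by continuous
functions with convex sublevel sets: maxima of truncated affine functions that vanish on the
tangents. -/
theorem exists_separated_finset (hd : 2 ≤ d) {h : ℝ} (h0 : 0 ≤ h) (h1 : h ≤ 1) (n : ℕ) :
    ∃ S : Finset (UnitCube d), S.card = n ∧ ∀ E ⊆ S, ∃ f : UnitCube d → unitInterval,
      Continuous f ∧ (HasConvexSublevels fun x => (f x : ℝ)) ∧ (∀ x, (f x : ℝ) ≤ h) ∧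
      ∀ x ∈ S, (x ∈ E → (f x : ℝ) = h) ∧ (x ∉ E → (f x : ℝ) = 0) := by
  classical
  let t : Fin n → unitInterval := fun i => ⟨i / n, by positivity,
    div_le_one_of_le₀ (by exact_mod_cast i.2.le) (by positivity)⟩
  have hsep : ∀ i j : Fin n, i ≠ j → 1 ≤ (n : ℝ) ^ 2 * ((t j : ℝ) - t i) ^ 2 := fun i j hij => by
    have hn : (n : ℝ) ≠ 0 := by exact_mod_cast (Fin.pos i).ne'
    have e : (n : ℝ) ^ 2 * ((t j : ℝ) - t i) ^ 2 = (((j : ℤ) - (i : ℤ) : ℤ) : ℝ) ^ 2 := by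
      simp only [t]
      push_cast
      field_simp
    have hne : (j : ℤ) - (i : ℤ) ≠ 0 := fun h => hij (Fin.ext (by omega))
    rw [e]
    have : 0 < ((j : ℤ) - (i : ℤ)) ^ 2 := by positivity
    exact_mod_cast this
  have ht : Function.Injective fun i => parabolaPoint d (t i) := fun i j hij => by
    by_contra hne
    have h2 := hsep i j hne
    have h3 : t i = t j := by
      simpa [parabolaPoint] using congrFun hij ⟨0, by omega⟩
    rw [h3] at h2
    norm_num at h2
  -- distinct parameters `i / n` differ by at least `1 / n`, so the slope `n²` brings the bump of
  -- one point down to `0` at all others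
  refine ⟨Finset.univ.map ⟨_, ht⟩, by simp, fun E _ => ?_⟩
  let g : Fin n → UnitCube d → unitInterval := fun i => tangentBump hd h1 ((n : ℝ) ^ 2) (t i)
  let F : Finset (Fin n) := Finset.univ.filter fun i => parabolaPoint d (t i) ∈ E
  have hle : ∀ x, ((F.sup fun i => g i x : unitInterval) : ℝ) ≤ h := fun x => by
    have : (F.sup fun i => g i x) ≤ (⟨h, h0, h1⟩ : unitInterval) :=
      Finset.sup_le fun i _ => tangentBump_le hd h1 _ _ h0 x
    exact this
  refine ⟨fun x => F.sup fun i => g i x,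
    Continuous.finset_sup_apply fun i _ => continuous_tangentBump hd h1 _ _,
    HasConvexSublevels.finset_sup F fun i _ => hasConvexSublevels_tangentBump hd h1 _ _ h0,
    hle, fun x hx => ?_⟩
  obtain ⟨j, -, rfl⟩ := Finset.mem_map.1 hx
  refine ⟨fun hj => le_antisymm (hle _) ?_, fun hj => ?_⟩
  · have e : (g j (parabolaPoint d (t j)) : ℝ) = h := by
      simp only [g, tangentBump_parabolaPoint]
      simp [h0]
    have : g j (parabolaPoint d (t j)) ≤ F.sup fun i => g i (parabolaPoint d (t j)) :=
      Finset.le_sup (f := fun i => g i (parabolaPoint d (t j)))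
        (Finset.mem_filter.2 ⟨Finset.mem_univ _, hj⟩)
    exact e.symm.le.trans this
  · have : (F.sup fun i => g i (parabolaPoint d (t j))) ≤ 0 := Finset.sup_le fun i hi => by
      have hij : i ≠ j := fun h => hj (h ▸ (Finset.mem_filter.1 hi).2)
      have h2 := hsep i j hij
      have : (g i (parabolaPoint d (t j)) : ℝ) ≤ 0 := by
        simp only [g, tangentBump_parabolaPoint]
        exact max_le le_rfl ((min_le_right _ _).trans (by linarith))
      exact this
    exact congrArg Subtype.val (le_antisymm this bot_le)

end Parabola

/-! ### Shattered sets -/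

section Shattering

variable {K : Type u} [Field K] {d : ℕ} {V γ : ℝ} {H : Set (UnitCube d → unitInterval)}

theorem sub_le_of_mem_boundedPersistenceClass (hV : 0 ≤ V) {f : UnitCube d → unitInterval}
    (hf : f ∈ boundedPersistenceClass K d V) (x y : UnitCube d) : (f y : ℝ) - f x ≤ V :=
  (ENNReal.ofReal_le_ofReal_iff hV).1
    ((ofReal_sub_le_clippedPersistence (K := K) (fun x => (f x).2.1) (fun x => (f x).2.2)
      (hf.1 0) x y).trans ((ENNReal.le_tsum 0).trans hf.2))

theorem sum_abs_sub_le_of_mem_boundedPersistenceClass (hV : 0 ≤ V)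
    {f : UnitCube 1 → unitInterval} (hf : f ∈ boundedPersistenceClass K 1 V) {n : ℕ}
    {x : ℕ → UnitCube 1} (hx : ∀ i j, i < j → j ≤ n → x i 0 < x j 0) :
    ∑ i ∈ Finset.range n, |(f (x (i + 1)) : ℝ) - f (x i)| / 2 ≤ V :=
  (ENNReal.ofReal_le_ofReal_iff hV).1
    ((sum_abs_sub_le_clippedPersistence (K := K) (fun x => (f x).2.1) (fun x => (f x).2.2)
      (hf.1 0) hx).trans ((ENNReal.le_tsum 0).trans hf.2))

theorem IsFatShatteredStrict.isFatShattered {X : Type*} {F : Set (X → unitInterval)}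
    {S : Finset X} (hS : IsFatShatteredStrict γ F S) : IsFatShattered γ F S := by
  obtain ⟨r, hr⟩ := hS
  refine ⟨r, fun E hE => ?_⟩
  obtain ⟨f, hf, h⟩ := hr E hE
  exact ⟨f, hf, fun x hx => ⟨(h x hx).1, fun hxE => ((h x hx).2 hxE).le⟩⟩

theorem fatDimStrict_le_fatDim {X : Type*} (γ : ℝ) (F : Set (X → unitInterval)) :
    fatDimStrict γ F ≤ fatDim γ F :=
  iSup_mono fun _ => iSup_mono' fun hS => ⟨hS.isFatShattered, le_rfl⟩

theorem card_le_one_of_forall_not_le {X : Type*} {S : Finset X} {r : X → ℝ}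
    (key : ∀ x ∈ S, ∀ y ∈ S, x ≠ y → ¬ r y ≤ r x) : S.card ≤ 1 := by
  refine Finset.card_le_one.2 fun x hx y hy => ?_
  by_contra hxy
  rcases le_total (r y) (r x) with h | h
  exacts [key x hx y hy hxy h, key y hy x hx (Ne.symm hxy) h]

/-- Any two points of a shattered set are separated by `2γ` by some function of the class: the
point with the larger threshold is put above it, the other one below. -/
theorem card_le_one_of_isFatShattered (hH : H ⊆ boundedPersistenceClass K d V) (hV : 0 ≤ V)
    (hVγ : V < 2 * γ) {S : Finset (UnitCube d)} (hS : IsFatShattered γ H S) : S.card ≤ 1 := by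
  obtain ⟨r, hr⟩ := hS
  refine card_le_one_of_forall_not_le (r := r) fun x hx y hy hxy hle => ?_
  obtain ⟨f, hf, h⟩ := hr {x} (by simpa using hx)
  have h1 := (h x hx).1 (Finset.mem_singleton_self x)
  have h2 := (h y hy).2 (by simpa using hxy.symm)
  linarith [sub_le_of_mem_boundedPersistenceClass hV (hH hf) y x]

theorem card_le_one_of_isFatShatteredStrict (hH : H ⊆ boundedPersistenceClass K d V)
    (hV : 0 ≤ V) (hVγ : V ≤ 2 * γ) {S : Finset (UnitCube d)}
    (hS : IsFatShatteredStrict γ H S) : S.card ≤ 1 := by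
  obtain ⟨r, hr⟩ := hS
  refine card_le_one_of_forall_not_le (r := r) fun x hx y hy hxy hle => ?_
  obtain ⟨f, hf, h⟩ := hr {x} (by simpa using hx)
  have h1 := (h x hx).1 (Finset.mem_singleton_self x)
  have h2 := (h y hy).2 (by simpa using hxy.symm)
  linarith [sub_le_of_mem_boundedPersistenceClass hV (hH hf) y x]

/-- The constant functions `0` and `1` shatter a point. -/
theorem one_le_fatDimStrict (hH : {f ∈ boundedPersistenceClass K d V | Continuous f} ⊆ H)
    (hV : 0 ≤ V) (hγ : γ < 1 / 2) : 1 ≤ fatDimStrict γ H := by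
  classical
  have hconst : ∀ c : unitInterval, (fun _ => c) ∈ H := fun c => by
    refine hH ⟨⟨qTame_of_contractible_sublevels K
      fun t => (hasConvexSublevels_const (c : ℝ)).contractibleSpace,
      (totalPersistence_le_of_contractible_sublevels K ⟨0, ?_⟩
        fun t => (hasConvexSublevels_const (c : ℝ)).contractibleSpace).trans ?_⟩,
      continuous_const⟩
    · rintro _ ⟨x, rfl⟩
      exact c.2.1
    · rw [Set.range_const, csSup_singleton, csInf_singleton, sub_self]
      exact ENNReal.ofReal_le_ofReal hV
  let x : UnitCube d := fun _ => 0
  have hS : IsFatShatteredStrict γ H {x} := by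
    refine ⟨fun _ => 1 / 2, fun E _ => ⟨fun _ => if x ∈ E then 1 else 0, hconst _, ?_⟩⟩
    intro y hy
    rw [Finset.mem_singleton.1 hy]
    refine ⟨fun h => ?_, fun h => ?_⟩
    · rw [if_pos h, Set.Icc.coe_one]
      linarith
    · rw [if_neg h, Set.Icc.coe_zero]
      linarith
  exact le_iSup₂_of_le {x} hS (by simp)

theorem natCast_le_fatDim (hd : 2 ≤ d)
    (hH : {f ∈ boundedPersistenceClass K d V | Continuous f} ⊆ H) (hγ : 0 < γ)
    (hγ' : γ < 1 / 2) (hV : 2 * γ ≤ V) (n : ℕ) : (n : ℕ∞) ≤ fatDim γ H := by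
  obtain ⟨S, hS, hE⟩ := exists_separated_finset hd (h := 2 * γ) (by linarith) (by linarith) n
  refine le_iSup₂_of_le S ⟨fun _ => γ, fun E hES => ?_⟩ (by rw [hS])
  obtain ⟨f, hf1, hf2, hf3, hf4⟩ := hE E hES
  refine ⟨f, hH ⟨mem_boundedPersistenceClass_of_hasConvexSublevels hf2 hf3 hV, hf1⟩,
    fun x hx => ⟨fun h => ?_, fun h => ?_⟩⟩
  · rw [(hf4 x hx).1 h]; linarith
  · rw [(hf4 x hx).2 h]; linarith

theorem natCast_le_fatDimStrict (hd : 2 ≤ d)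
    (hH : {f ∈ boundedPersistenceClass K d V | Continuous f} ⊆ H) (hγ : 0 < γ)
    (hγ' : γ < 1 / 2) (hV : 2 * γ < V) (n : ℕ) : (n : ℕ∞) ≤ fatDimStrict γ H := by
  have hh : 2 * γ < min V 1 := lt_min hV (by linarith)
  obtain ⟨S, hS, hE⟩ := exists_separated_finset hd (h := min V 1) (by linarith)
    (min_le_right _ _) n
  refine le_iSup₂_of_le S ⟨fun _ => min V 1 - γ, fun E hES => ?_⟩ (by rw [hS])
  obtain ⟨f, hf1, hf2, hf3, hf4⟩ := hE E hES
  refine ⟨f, hH ⟨mem_boundedPersistenceClass_of_hasConvexSublevels hf2 hf3 (min_le_left _ _),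
    hf1⟩, fun x hx => ⟨fun h => ?_, fun h => ?_⟩⟩
  · rw [(hf4 x hx).1 h]; linarith
  · rw [(hf4 x hx).2 h]; linarith

/-- A function that is above the thresholds at every other point of a shattered set, together with
the complementary one, varies by `4γ` between any two consecutive points, whatever the
thresholds are. -/
theorem card_le_of_isFatShattered_interval {H : Set (UnitCube 1 → unitInterval)}
    (hH : H ⊆ boundedPersistenceClass K 1 V) (hγ : 0 < γ) (hV : 0 ≤ V)
    {S : Finset (UnitCube 1)} (hS : IsFatShattered γ H S) : S.card ≤ 1 + ⌊V / γ⌋₊ := by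
  classical
  -- `S` has `n + 1` points, hence `n` gaps
  rcases S.card.eq_zero_or_eq_succ_pred with h | hn
  · omega
  set n := S.card.pred
  have hinj : Function.Injective fun y : UnitCube 1 => y 0 := fun y z h => by
    ext i
    rw [Subsingleton.elim i 0]
    exact congrArg Subtype.val h
  have hcard : (S.image fun y => y 0).card = n + 1 := by
    rw [Finset.card_image_of_injective _ hinj, hn]
  let x : ℕ → UnitCube 1 := fun i =>
    -- the value beyond the last point is irrelevant
    if hi : i < n + 1 then fun _ => (S.image fun y => y 0).orderEmbOfFin hcard ⟨i, hi⟩ else 0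
  have hx : ∀ i j, i < j → j ≤ n → x i 0 < x j 0 := fun i j hij hj => by
    simp only [x, dif_pos (show i < n + 1 by omega), dif_pos (show j < n + 1 by omega)]
    exact OrderEmbedding.strictMono _ (Fin.mk_lt_mk.2 hij)
  have hxS : ∀ i ≤ n, x i ∈ S := fun i hi => by
    have h1 := Finset.orderEmbOfFin_mem (S.image fun y => y 0) hcard ⟨i, by omega⟩
    obtain ⟨y, hy, h2⟩ := Finset.mem_image.1 h1
    have : x i = y := hinj (by
      simp only [x, dif_pos (show i < n + 1 by omega)]
      exact h2.symm)
    rwa [this]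
  have hxinj : ∀ i ≤ n, ∀ j ≤ n, x i = x j → i = j := fun i hi j hj hij => by
    rcases lt_trichotomy i j with h | h | h
    · exact absurd (congrFun hij 0) (hx i j h hj).ne
    · exact h
    · exact absurd (congrFun hij 0) (hx j i h hi).ne'
  obtain ⟨r, hr⟩ := hS
  let E : Finset (UnitCube 1) := S.filter fun y => ∃ i ≤ n, Even i ∧ x i = y
  have hE : ∀ i ≤ n, (x i ∈ E ↔ Even i) := fun i hi => by
    refine ⟨fun h => ?_, fun h => Finset.mem_filter.2 ⟨hxS i hi, i, hi, h, rfl⟩⟩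
    obtain ⟨j, hj, hj', hij⟩ := (Finset.mem_filter.1 h).2
    rwa [← hxinj j hj i hi hij]
  have hE' : ∀ i ≤ n, (x i ∈ S \ E ↔ ¬ Even i) := fun i hi => by
    rw [Finset.mem_sdiff, hE i hi, and_iff_right (hxS i hi)]
  obtain ⟨f, hf, hfE⟩ := hr E (Finset.filter_subset _ _)
  obtain ⟨g, hg, hgE⟩ := hr (S \ E) Finset.sdiff_subset
  have h1 := sum_abs_sub_le_of_mem_boundedPersistenceClass hV (hH hf) hx
  have h2 := sum_abs_sub_le_of_mem_boundedPersistenceClass hV (hH hg) hx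
  have h3 : ∀ i ∈ Finset.range n, 2 * γ ≤ |(f (x (i + 1)) : ℝ) - f (x i)| / 2 +
      |(g (x (i + 1)) : ℝ) - g (x i)| / 2 := fun i hi => by
    have hi' : i + 1 ≤ n := Finset.mem_range.1 hi
    have f1 := hfE _ (hxS i (by omega))
    have f2 := hfE _ (hxS (i + 1) hi')
    have g1 := hgE _ (hxS i (by omega))
    have g2 := hgE _ (hxS (i + 1) hi')
    rw [hE i (by omega)] at f1
    rw [hE (i + 1) hi'] at f2
    rw [hE' i (by omega)] at g1
    rw [hE' (i + 1) hi'] at g2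
    rw [Nat.even_add_one] at f2 g2
    by_cases hev : Even i
    · have a1 := f1.1 hev
      have a2 := f2.2 (not_not.2 hev)
      have a3 := g1.2 (not_not.2 hev)
      have a4 := g2.1 (by simpa using hev)
      linarith [neg_abs_le ((f (x (i + 1)) : ℝ) - f (x i)),
        le_abs_self ((g (x (i + 1)) : ℝ) - g (x i))]
    · have a1 := f1.2 hev
      have a2 := f2.1 hev
      have a3 := g1.1 hev
      have a4 := g2.2 (by simpa using hev)
      linarith [neg_abs_le ((g (x (i + 1)) : ℝ) - g (x i)),
        le_abs_self ((f (x (i + 1)) : ℝ) - f (x i))]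
  have h4 := Finset.sum_le_sum h3
  rw [Finset.sum_add_distrib, Finset.sum_const, Finset.card_range, nsmul_eq_mul] at h4
  have h5 : n ≤ ⌊V / γ⌋₊ := Nat.le_floor (by rw [le_div_iff₀ hγ]; linarith)
  omega

end Shattering

theorem mainTheorem3 (K : Type u) [Field K] (γ V : ℝ) (hγ : 0 < γ) (hγ' : γ < 1 / 2)
    (hV : 0 ≤ V) :
    (∀ H : Set (UnitCube 1 → unitInterval),
      (H = boundedPersistenceClass K 1 V ∨
        H = {f ∈ boundedPersistenceClass K 1 V | Continuous f}) →
      fatDim γ H ≤ ((1 + ⌊V / γ⌋₊ : ℕ) : ℕ∞) ∧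
      fatDimStrict γ H ≤ ((1 + ⌊V / γ⌋₊ : ℕ) : ℕ∞)) ∧
    (∀ d : ℕ, 2 ≤ d → ∀ H : Set (UnitCube d → unitInterval),
      (H = boundedPersistenceClass K d V ∨
        H = {f ∈ boundedPersistenceClass K d V | Continuous f}) →
      (2 * γ ≤ V → fatDim γ H = ⊤) ∧
      (V < 2 * γ → fatDim γ H = 1) ∧
      (2 * γ < V → fatDimStrict γ H = ⊤) ∧
      (V ≤ 2 * γ → fatDimStrict γ H = 1)) := by
  refine ⟨fun H hH => ?_, fun d hd H hH => ?_⟩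
  · have hsub : H ⊆ boundedPersistenceClass K 1 V := by
      rcases hH with rfl | rfl
      exacts [subset_rfl, Set.sep_subset _ _]
    have h : fatDim γ H ≤ ((1 + ⌊V / γ⌋₊ : ℕ) : ℕ∞) := iSup₂_le fun S hS =>
      Nat.cast_le.2 (card_le_of_isFatShattered_interval hsub hγ hV hS)
    exact ⟨h, (fatDimStrict_le_fatDim γ H).trans h⟩
  · have hsub : H ⊆ boundedPersistenceClass K d V := by
      rcases hH with rfl | rfl
      exacts [subset_rfl, Set.sep_subset _ _]
    have hsup : {f ∈ boundedPersistenceClass K d V | Continuous f} ⊆ H := by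
      rcases hH with rfl | rfl
      exacts [Set.sep_subset _ _, subset_rfl]
    have hone := one_le_fatDimStrict hsup hV hγ'
    refine ⟨fun h => ?_, fun h => le_antisymm (iSup₂_le fun S hS => ?_)
      (hone.trans (fatDimStrict_le_fatDim γ H)), fun h => ?_,
      fun h => le_antisymm (iSup₂_le fun S hS => ?_) hone⟩
    · exact ENat.eq_top_iff_forall_ge.2 fun n => natCast_le_fatDim hd hsup hγ hγ' h n
    · exact_mod_cast card_le_one_of_isFatShattered hsub hV h hS
    · exact ENat.eq_top_iff_forall_ge.2 fun n => natCast_le_fatDimStrict hd hsup hγ hγ' h n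
    · exact_mod_cast card_le_one_of_isFatShatteredStrict hsub hV h hS
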